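/- Let $\mathcal E$ be a Euclidean affine space of dimension $3$ with associated vector space $V$, and let $\mathcal L$ be the set of oriented straight lines of $\mathcal E$. Denote by $\vec u(\ell)$ the unit directing vector of $\ell\in\mathcal L$. The set $\mathcal L$ carries its natural structure of smooth $4$-dimensional manifold and, for an origin $O\in\mathcal E$ and any smooth choice of a point $P(\ell)\in\ell$ (for instance the orthogonal projection of $O$ on $\ell$), the symplectic form $$\omega_{\mathcal L}=\mathrm d\overrightarrow{OP}\wedge\mathrm d\vec u,\qquad \omega_{\mathcal L}(\xi,\eta)=\mathrm d\overrightarrow{OP}(\xi)\cdot\mathrm d\vec u(\eta)-\mathrm d\overrightarrow{OP}(\eta)\cdot\mathrm d\vec u(\xi),$$ which depends neither on $O$ nor on the choice of $P$. A two-parameter family of rays is a smooth manifold $\mathcal F$ of dimension $2$ immersed in $\mathcal L$ (not necessarily embedded); for $x\in\mathcal F$ let $L(x)\in\mathcal L$ be the corresponding ray. "Smooth surface" means smooth embedded surface of $\mathcal E$. A point $m_0\in L(x_0)$ is a regular point of the ray $L(x_0)$ if, for every smooth surface $S\subset\mathcal E$ containing $m_0$ and transverse to $L(x_0)$ at $m_0$,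 there are an open neighbourhood $U$ of $x_0$ in $\mathcal F$ and an open neighbourhood $S'$ of $m_0$ in $S$ such that for each $x\in U$ the ray $L(x)$ meets $S'$ at a unique point $m(x)$, and $x\mapsto m(x)$ is a diffeomorphism of $U$ onto $S'$. The family is rectangular if for every $x_0\in\mathcal F$ and every regular point $m_0$ of $L(x_0)$ there are a smooth surface $S$ containing $m_0$ and an open neighbourhood $U$ of $x_0$ in $\mathcal F$ such that for each $x\in U$ the ray $L(x)$ meets $S$, and is orthogonal to $S$ at each of their common points. The family is Lagrangian if the pull-back of $\omega_{\mathcal L}$ to $\mathcal F$ vanishes (the dimension of $\mathcal F$ being half that of $\mathcal L$). Then every Lagrangian two-parameter family of rays is rectangular. Moreover, if on each ray of the two-parameter family there exists at least one regular point, then the family is rectangular if and only if it is Lagrangian, i.e. an immersed Lagrangian submanifold of $(\mathcal L,\omega_{\mathcal L})$. -/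

import Mathlib

open scoped Manifold ContDiff Topology

noncomputable section

/-- An oriented straight line of the Euclidean affine space `E` with vector space `V`:
a line together with one of its two unit directing vectors. -/
@[ext]
structure OrientedLine (V E : Type*) [NormedAddCommGroup V] [InnerProductSpace ℝ V]
    [MetricSpace E] [NormedAddTorsor V E] where
  carrier : AffineSubspace ℝ E
  dir : V
  norm_dir : ‖dir‖ = 1
  nonempty : (carrier : Set E).Nonempty
  direction_eq : carrier.direction = Submodule.span ℝ {dir}

namespace OrientedLine

variable {V E : Type*} [NormedAddCommGroup V] [InnerProductSpace ℝ V]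
  [MetricSpace E] [NormedAddTorsor V E]

instance : Membership E (OrientedLine V E) := ⟨fun ℓ p => p ∈ ℓ.carrier⟩

/-- The oriented line through the point `p` with unit directing vector `u`. -/
def through (p : E) (u : Metric.sphere (0 : V) 1) : OrientedLine V E where
  carrier := AffineSubspace.mk' p (Submodule.span ℝ {(u : V)})
  dir := u
  norm_dir := norm_eq_of_mem_sphere u
  nonempty := ⟨p, AffineSubspace.self_mem_mk' _ _⟩
  direction_eq := AffineSubspace.direction_mk' _ _

/-- The space of oriented lines is a quotient of the space of pointed oriented lines. -/
instance : TopologicalSpace (OrientedLine V E) :=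
  TopologicalSpace.coinduced (fun x : E × Metric.sphere (0 : V) 1 => through x.1 x.2) inferInstance

/-- Some point of the line. -/
def point (ℓ : OrientedLine V E) : E := ℓ.nonempty.some

lemma point_mem (ℓ : OrientedLine V E) : ℓ.point ∈ ℓ := ℓ.nonempty.some_mem

lemma self_mem_through (p : E) (u : Metric.sphere (0 : V) 1) : p ∈ through p u :=
  AffineSubspace.self_mem_mk' _ _

lemma eq_of_mem {ℓ ℓ' : OrientedLine V E} {p : E} (hp : p ∈ ℓ) (hp' : p ∈ ℓ')
    (h : ℓ.dir = ℓ'.dir) : ℓ = ℓ' := by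
  refine OrientedLine.ext ?_ h
  refine AffineSubspace.ext_of_direction_eq ?_ ⟨p, hp, hp'⟩
  rw [ℓ.direction_eq, ℓ'.direction_eq, h]

lemma exists_eq_add_smul (ℓ : OrientedLine V E) {p q : E} (hp : p ∈ ℓ) (hq : q ∈ ℓ) :
    ∃ t : ℝ, q -ᵥ p = t • ℓ.dir := by
  have h : q -ᵥ p ∈ ℓ.carrier.direction := AffineSubspace.vsub_mem_direction hq hp
  rw [ℓ.direction_eq, Submodule.mem_span_singleton] at h
  obtain ⟨t, ht⟩ := h
  exact ⟨t, ht.symm⟩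

lemma smul_vadd_mem (ℓ : OrientedLine V E) {p : E} (hp : p ∈ ℓ) (t : ℝ) :
    t • ℓ.dir +ᵥ p ∈ ℓ := by
  refine AffineSubspace.vadd_mem_of_mem_direction ?_ hp
  rw [ℓ.direction_eq]
  exact Submodule.smul_mem _ _ (Submodule.mem_span_singleton_self _)

lemma through_surjective :
    Function.Surjective (fun x : E × Metric.sphere (0 : V) 1 => through x.1 x.2) := fun ℓ =>
  ⟨(ℓ.point, ⟨ℓ.dir, by simp [ℓ.norm_dir]⟩),
    eq_of_mem (self_mem_through _ _) ℓ.point_mem rfl⟩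

lemma isQuotientMap_through :
    Topology.IsQuotientMap (fun x : E × Metric.sphere (0 : V) 1 => through x.1 x.2) :=
  ⟨⟨rfl⟩, through_surjective⟩

lemma continuous_dir : Continuous (dir : OrientedLine V E → V) := by
  rw [isQuotientMap_through.continuous_iff]
  exact continuous_subtype_val.comp continuous_snd

/-! ### Charts

In the frame `(O, b)` a line which is oriented by increasing third coordinate `z` is
`x = y₀ z + y₂`, `y = y₁ z + y₃`. -/

/-- The numbers `(y₀, y₁, y₂, y₃)` for the line through `O + v` with directing vector `u`. -/
def frameCoord (b : OrthonormalBasis (Fin 3) ℝ V) (v u : V) : EuclideanSpace ℝ (Fin 4) :=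
  !₂[inner ℝ (b 0) u / inner ℝ (b 2) u,
     inner ℝ (b 1) u / inner ℝ (b 2) u,
     inner ℝ (b 0) v - inner ℝ (b 2) v * (inner ℝ (b 0) u / inner ℝ (b 2) u),
     inner ℝ (b 1) v - inner ℝ (b 2) v * (inner ℝ (b 1) u / inner ℝ (b 2) u)]

/-- A directing vector of the line with coordinates `y`. -/
def frameDir (b : OrthonormalBasis (Fin 3) ℝ V) (y : EuclideanSpace ℝ (Fin 4)) : V :=
  y 0 • b 0 + y 1 • b 1 + b 2

/-- The position relative to `O` of a point of the line with coordinates `y`. -/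
def framePos (b : OrthonormalBasis (Fin 3) ℝ V) (y : EuclideanSpace ℝ (Fin 4)) : V :=
  y 2 • b 0 + y 3 • b 1

lemma inner_basis (b : OrthonormalBasis (Fin 3) ℝ V) (i j : Fin 3) :
    inner ℝ (b i) (b j) = if i = j then (1 : ℝ) else 0 :=
  orthonormal_iff_ite.mp b.orthonormal i j

lemma frameDir_ne_zero (b : OrthonormalBasis (Fin 3) ℝ V) (y : EuclideanSpace ℝ (Fin 4)) :
    frameDir b y ≠ 0 := by
  intro h
  have : inner ℝ (b 2) (frameDir b y) = (1 : ℝ) := by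
    simp [frameDir, inner_add_right, inner_smul_right]
  simp [h] at this

/-- The unit directing vector of the line with coordinates `y`. -/
def frameUnit (b : OrthonormalBasis (Fin 3) ℝ V) (y : EuclideanSpace ℝ (Fin 4)) :
    Metric.sphere (0 : V) 1 :=
  ⟨‖frameDir b y‖⁻¹ • frameDir b y, by
    simp [norm_smul, inv_mul_cancel₀ (norm_ne_zero_iff.mpr (frameDir_ne_zero b y))]⟩

lemma frameCoord_smul (b : OrthonormalBasis (Fin 3) ℝ V) (v u : V) {r : ℝ} (hr : r ≠ 0) :
    frameCoord b v (r • u) = frameCoord b v u := by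
  simp [frameCoord, inner_smul_right, mul_div_mul_left _ _ hr]

lemma frameCoord_add_smul (b : OrthonormalBasis (Fin 3) ℝ V) (v u : V) (t : ℝ)
    (hu : inner ℝ (b 2) u ≠ (0 : ℝ)) :
    frameCoord b (v + t • u) u = frameCoord b v u := by
  ext i
  fin_cases i <;> simp [frameCoord, inner_smul_right, inner_add_right] <;> field_simp <;> ring

lemma frameCoord_frame (b : OrthonormalBasis (Fin 3) ℝ V) (y : EuclideanSpace ℝ (Fin 4)) :
    frameCoord b (framePos b y) (frameDir b y) = y := by
  ext i
  fin_cases i <;>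
    simp [frameCoord, framePos, frameDir, inner_smul_right, inner_add_right]

lemma eq_sum_basis (b : OrthonormalBasis (Fin 3) ℝ V) (v : V) :
    v = (inner ℝ (b 0) v : ℝ) • b 0 + (inner ℝ (b 1) v : ℝ) • b 1 + (inner ℝ (b 2) v : ℝ) • b 2 := by
  conv_lhs => rw [← b.sum_repr' v]
  rw [Fin.sum_univ_three]

lemma frameDir_frameCoord (b : OrthonormalBasis (Fin 3) ℝ V) (v u : V)
    (hu : inner ℝ (b 2) u ≠ (0 : ℝ)) :
    frameDir b (frameCoord b v u) = (inner ℝ (b 2) u : ℝ)⁻¹ • u := by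
  conv_rhs => rw [eq_sum_basis b u]
  simp only [frameDir, frameCoord, smul_add, smul_smul, inner_add_right, inner_smul_right,
    inner_basis]
  simp [div_eq_inv_mul, inv_mul_cancel₀ hu]

lemma framePos_frameCoord (b : OrthonormalBasis (Fin 3) ℝ V) (v u : V)
    (hu : inner ℝ (b 2) u ≠ (0 : ℝ)) :
    framePos b (frameCoord b v u) = v - ((inner ℝ (b 2) v : ℝ) / inner ℝ (b 2) u) • u := by
  have key : ∀ v₀ v₁ v₂ u₀ u₁ u₂ : ℝ, u₂ ≠ 0 →
      (v₀ - v₂ * (u₀ / u₂)) • b 0 + (v₁ - v₂ * (u₁ / u₂)) • b 1 =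
        (v₀ • b 0 + v₁ • b 1 + v₂ • b 2) - (v₂ / u₂) • (u₀ • b 0 + u₁ • b 1 + u₂ • b 2) := by
    intro v₀ v₁ v₂ u₀ u₁ u₂ h
    have h2 : v₂ • b 2 = (v₂ / u₂ * u₂) • b 2 := by rw [div_mul_cancel₀ _ h]
    rw [h2]
    module
  have h := key (inner ℝ (b 0) v) (inner ℝ (b 1) v) (inner ℝ (b 2) v)
    (inner ℝ (b 0) u) (inner ℝ (b 1) u) (inner ℝ (b 2) u) hu
  rw [← eq_sum_basis b v, ← eq_sum_basis b u] at h
  exact h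

lemma frameCoord_eq_of_mem (O : E) (b : OrthonormalBasis (Fin 3) ℝ V) {ℓ : OrientedLine V E}
    (hℓ : 0 < (inner ℝ (b 2) ℓ.dir : ℝ)) {p q : E} (hp : p ∈ ℓ) (hq : q ∈ ℓ) :
    frameCoord b (q -ᵥ O) ℓ.dir = frameCoord b (p -ᵥ O) ℓ.dir := by
  obtain ⟨t, ht⟩ := ℓ.exists_eq_add_smul hp hq
  rw [← vsub_add_vsub_cancel q p O, ht, add_comm, frameCoord_add_smul b _ _ _ hℓ.ne']

lemma contDiffOn_frameCoord (b : OrthonormalBasis (Fin 3) ℝ V) :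
    ContDiffOn ℝ ∞ (fun x : V × V => frameCoord b x.1 x.2)
      {x | (inner ℝ (b 2) x.2 : ℝ) ≠ 0} := by
  rw [contDiffOn_euclidean]
  have h1 : ∀ i, ContDiff ℝ ∞ (fun x : V × V => (inner ℝ (b i) x.1 : ℝ)) := fun i =>
    contDiff_const.inner ℝ contDiff_fst
  have h2 : ∀ i, ContDiff ℝ ∞ (fun x : V × V => (inner ℝ (b i) x.2 : ℝ)) := fun i =>
    contDiff_const.inner ℝ contDiff_snd
  have h3 : ∀ i, ContDiffOn ℝ ∞
      (fun x : V × V => (inner ℝ (b i) x.2 : ℝ) / inner ℝ (b 2) x.2)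
      {x | (inner ℝ (b 2) x.2 : ℝ) ≠ 0} := fun i =>
    (h2 i).contDiffOn.div (h2 2).contDiffOn fun x hx => hx
  intro i
  fin_cases i
  · exact h3 0
  · exact h3 1
  · exact (h1 0).contDiffOn.sub ((h1 2).contDiffOn.mul (h3 0))
  · exact (h1 1).contDiffOn.sub ((h1 2).contDiffOn.mul (h3 1))

lemma contDiff_frameDir (b : OrthonormalBasis (Fin 3) ℝ V) : ContDiff ℝ ∞ (frameDir b) := by
  unfold frameDir
  fun_prop

lemma contDiff_framePos (b : OrthonormalBasis (Fin 3) ℝ V) : ContDiff ℝ ∞ (framePos b) := by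
  unfold framePos
  fun_prop

lemma contDiff_frameUnit (b : OrthonormalBasis (Fin 3) ℝ V) :
    ContDiff ℝ ∞ (fun y => (frameUnit b y : V)) := by
  have h : ContDiff ℝ ∞ (fun y => ‖frameDir b y‖) :=
    (contDiff_frameDir b).norm ℝ (frameDir_ne_zero b)
  exact (h.inv fun y => norm_ne_zero_iff.mpr (frameDir_ne_zero b y)).smul (contDiff_frameDir b)

lemma inner_frameUnit_pos (b : OrthonormalBasis (Fin 3) ℝ V) (y : EuclideanSpace ℝ (Fin 4)) :
    0 < (inner ℝ (b 2) (frameUnit b y : V) : ℝ) := by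
  have h : inner ℝ (b 2) (frameDir b y) = (1 : ℝ) := by
    simp [frameDir, inner_add_right, inner_smul_right]
  simpa [frameUnit, inner_smul_right, h] using frameDir_ne_zero b y

lemma isOpen_frameSource (b : OrthonormalBasis (Fin 3) ℝ V) :
    IsOpen {ℓ : OrientedLine V E | 0 < (inner ℝ (b 2) ℓ.dir : ℝ)} :=
  isOpen_lt continuous_const (continuous_const.inner continuous_dir)

lemma frameCoord_point_through (O : E) (b : OrthonormalBasis (Fin 3) ℝ V) (p : E)
    (u : Metric.sphere (0 : V) 1) (h : 0 < (inner ℝ (b 2) (u : V) : ℝ)) :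
    frameCoord b ((through p u).point -ᵥ O) (through p u).dir = frameCoord b (p -ᵥ O) u :=
  frameCoord_eq_of_mem O b (ℓ := through p u) h (self_mem_through p u) (point_mem _)

lemma frameCoord_through_frame (O : E) (b : OrthonormalBasis (Fin 3) ℝ V)
    (y : EuclideanSpace ℝ (Fin 4)) :
    frameCoord b ((through (framePos b y +ᵥ O) (frameUnit b y)).point -ᵥ O)
      (through (framePos b y +ᵥ O) (frameUnit b y)).dir = y := by
  rw [frameCoord_point_through O b _ _ (inner_frameUnit_pos b y), vadd_vsub]
  change frameCoord b _ (‖frameDir b y‖⁻¹ • frameDir b y) = y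
  rw [frameCoord_smul _ _ _ (inv_ne_zero (norm_ne_zero_iff.mpr (frameDir_ne_zero b y))),
    frameCoord_frame]

lemma through_frameCoord (O : E) (b : OrthonormalBasis (Fin 3) ℝ V) {ℓ : OrientedLine V E}
    (hℓ : 0 < (inner ℝ (b 2) ℓ.dir : ℝ)) :
    through (framePos b (frameCoord b (ℓ.point -ᵥ O) ℓ.dir) +ᵥ O)
      (frameUnit b (frameCoord b (ℓ.point -ᵥ O) ℓ.dir)) = ℓ := by
  refine eq_of_mem (p := framePos b (frameCoord b (ℓ.point -ᵥ O) ℓ.dir) +ᵥ O)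
    (self_mem_through _ _) ?_ ?_
  · rw [framePos_frameCoord b _ _ hℓ.ne', sub_eq_add_neg, ← neg_smul, add_comm, add_vadd,
      vsub_vadd]
    exact ℓ.smul_vadd_mem ℓ.point_mem _
  · change (frameUnit b _ : V) = ℓ.dir
    simp only [frameUnit, frameDir_frameCoord b _ _ hℓ.ne', norm_smul, ℓ.norm_dir, smul_smul]
    rw [Real.norm_of_nonneg (inv_nonneg.mpr hℓ.le), mul_one, inv_inv, mul_inv_cancel₀ hℓ.ne',
      one_smul]

lemma continuousOn_frameCoord (O : E) (b : OrthonormalBasis (Fin 3) ℝ V) :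
    ContinuousOn (fun ℓ : OrientedLine V E => frameCoord b (ℓ.point -ᵥ O) ℓ.dir)
      {ℓ | 0 < (inner ℝ (b 2) ℓ.dir : ℝ)} := by
  rw [isQuotientMap_through.continuousOn_isOpen_iff (isOpen_frameSource b)]
  have h : ContinuousOn (fun x : E × Metric.sphere (0 : V) 1 => frameCoord b (x.1 -ᵥ O) x.2)
      {x | 0 < (inner ℝ (b 2) (x.2 : V) : ℝ)} :=
    (contDiffOn_frameCoord b).continuousOn.comp
      (((continuous_fst.vsub continuous_const).prodMk
        (continuous_subtype_val.comp continuous_snd)).continuousOn)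
      (fun x hx => ne_of_gt hx)
  exact h.congr fun x hx => frameCoord_point_through O b x.1 x.2 hx

lemma continuous_through_frame (O : E) (b : OrthonormalBasis (Fin 3) ℝ V) :
    Continuous (fun y => through (framePos b y +ᵥ O) (frameUnit b y)) := by
  have h : Continuous (fun y => (framePos b y +ᵥ O, frameUnit b y)) :=
    ((contDiff_framePos b).continuous.vadd continuous_const).prodMk
      ((contDiff_frameUnit b).continuous.subtype_mk _)
  have h' : Continuous (fun x : E × Metric.sphere (0 : V) 1 => through x.1 x.2) :=
    isQuotientMap_through.continuous
  exact h'.comp (f := fun y => (framePos b y +ᵥ O, frameUnit b y)) h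

/-- The chart of the space of oriented lines given by the frame `(O, b)`. -/
def frameChart (O : E) (b : OrthonormalBasis (Fin 3) ℝ V) :
    OpenPartialHomeomorph (OrientedLine V E) (EuclideanSpace ℝ (Fin 4)) where
  toFun ℓ := frameCoord b (ℓ.point -ᵥ O) ℓ.dir
  invFun y := through (framePos b y +ᵥ O) (frameUnit b y)
  source := {ℓ | 0 < (inner ℝ (b 2) ℓ.dir : ℝ)}
  target := Set.univ
  map_source' _ _ := Set.mem_univ _
  map_target' y _ := inner_frameUnit_pos b y
  left_inv' _ hℓ := through_frameCoord O b hℓ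
  right_inv' y _ := frameCoord_through_frame O b y
  open_source := isOpen_frameSource b
  open_target := isOpen_univ
  continuousOn_toFun := continuousOn_frameCoord O b
  continuousOn_invFun := (continuous_through_frame O b).continuousOn

lemma exists_basis [Fact (Module.finrank ℝ V = 3)] (ℓ : OrientedLine V E) :
    ∃ b : OrthonormalBasis (Fin 3) ℝ V, b 2 = ℓ.dir := by
  have h3 : Module.finrank ℝ V = 3 := Fact.out
  have : FiniteDimensional ℝ V := Module.finite_of_finrank_eq_succ h3
  have hv : Orthonormal ℝ (({2} : Set (Fin 3)).domRestrict fun _ => ℓ.dir) :=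
    ⟨fun _ => ℓ.norm_dir, fun i j hij => (hij (Subsingleton.elim i j)).elim⟩
  obtain ⟨b, hb⟩ := hv.exists_orthonormalBasis_extension_of_card_eq (by simp [h3])
  exact ⟨b, hb 2 rfl⟩

/-- The atlas consists of the charts of all frames `(O, b)`; no origin is preferred. -/
instance [Fact (Module.finrank ℝ V = 3)] :
    ChartedSpace (EuclideanSpace ℝ (Fin 4)) (OrientedLine V E) where
  atlas := Set.range fun x : E × OrthonormalBasis (Fin 3) ℝ V => frameChart x.1 x.2
  chartAt ℓ := frameChart ℓ.point (exists_basis ℓ).choose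
  mem_chart_source ℓ := by
    change 0 < (inner ℝ ((exists_basis ℓ).choose 2) ℓ.dir : ℝ)
    rw [(exists_basis ℓ).choose_spec, real_inner_self_eq_norm_sq, ℓ.norm_dir]
    norm_num
  chart_mem_atlas ℓ := ⟨(ℓ.point, (exists_basis ℓ).choose), rfl⟩

instance [Fact (Module.finrank ℝ V = 3)] : IsManifold (𝓡 4) ∞ (OrientedLine V E) := by
  apply isManifold_of_contDiffOn
  rintro _ _ ⟨⟨O, b⟩, rfl⟩ ⟨⟨O', b'⟩, rfl⟩
  have h : ContDiffOn ℝ ∞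
      (fun y => frameCoord b' (framePos b y + (O -ᵥ O')) (frameUnit b y : V))
      {y | 0 < (inner ℝ (b' 2) (frameUnit b y : V) : ℝ)} :=
    (contDiffOn_frameCoord b').comp
      (((contDiff_framePos b).add contDiff_const).prodMk (contDiff_frameUnit b)).contDiffOn
      (fun y hy => ne_of_gt hy)
  have hs : ∀ y, y ∈ (𝓡 4).symm ⁻¹'
      ((frameChart O b).symm ≫ₕ frameChart O' b').source ∩ Set.range (𝓡 4) →
      0 < (inner ℝ (b' 2) (frameUnit b y : V) : ℝ) := fun y hy => hy.1.2
  refine (h.mono hs).congr fun y hy => ?_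
  change frameCoord b' ((through (framePos b y +ᵥ O) (frameUnit b y)).point -ᵥ O')
    (through (framePos b y +ᵥ O) (frameUnit b y)).dir = _
  rw [frameCoord_point_through O' b' _ _ (hs y hy), vadd_vsub_assoc]

/-! ### The symplectic form -/

/-- The vector from the origin `O` to its orthogonal projection on the line `ℓ`. -/
def foot (O : E) (ℓ : OrientedLine V E) : V :=
  (ℓ.point -ᵥ O) - (inner ℝ ℓ.dir (ℓ.point -ᵥ O) : ℝ) • ℓ.dir

lemma foot_eq (O : E) {ℓ : OrientedLine V E} {p : E} (hp : p ∈ ℓ) :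
    foot O ℓ = (p -ᵥ O) - (inner ℝ ℓ.dir (p -ᵥ O) : ℝ) • ℓ.dir := by
  obtain ⟨t, ht⟩ := ℓ.exists_eq_add_smul hp ℓ.point_mem
  rw [foot, ← vsub_add_vsub_cancel ℓ.point p O, ht, inner_add_right, inner_smul_right,
    real_inner_self_eq_norm_sq, ℓ.norm_dir]
  simp only [one_pow, mul_one, add_smul]
  abel

lemma foot_vadd_mem (O : E) (ℓ : OrientedLine V E) : foot O ℓ +ᵥ O ∈ ℓ := by
  rw [foot, sub_eq_add_neg, ← neg_smul, add_comm, add_vadd, vsub_vadd]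
  exact ℓ.smul_vadd_mem ℓ.point_mem _

lemma inner_dir_foot (O : E) (ℓ : OrientedLine V E) : inner ℝ ℓ.dir (foot O ℓ) = (0 : ℝ) := by
  rw [foot, inner_sub_right, inner_smul_right, real_inner_self_eq_norm_sq, ℓ.norm_dir]
  simp

lemma foot_origin (O O' : E) (ℓ : OrientedLine V E) :
    foot O' ℓ = foot O ℓ + ((O -ᵥ O') - (inner ℝ (O -ᵥ O') ℓ.dir : ℝ) • ℓ.dir) := by
  rw [foot, foot, ← vsub_add_vsub_cancel ℓ.point O O', inner_add_right, add_smul,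
    real_inner_comm ℓ.dir (O -ᵥ O')]
  abel

lemma contDiff_foot_frame (O O' : E) (b : OrthonormalBasis (Fin 3) ℝ V) :
    ContDiff ℝ ∞ fun y => foot O (through (framePos b y +ᵥ O') (frameUnit b y)) := by
  have h : ContDiff ℝ ∞ fun y => framePos b y + (O' -ᵥ O) :=
    (contDiff_framePos b).add contDiff_const
  have hu := contDiff_frameUnit b
  have hf : (fun y => foot O (through (framePos b y +ᵥ O') (frameUnit b y))) =
      fun y => (framePos b y + (O' -ᵥ O)) -
        (inner ℝ (frameUnit b y : V) (framePos b y + (O' -ᵥ O)) : ℝ) • (frameUnit b y : V) := by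
    funext y
    rw [foot_eq O (self_mem_through _ _), vadd_vsub_assoc]
    rfl
  rw [hf]
  exact h.sub ((hu.inner ℝ h).smul hu)

variable [Fact (Module.finrank ℝ V = 3)]

lemma contMDiff_of_frame {W : Type*} [NormedAddCommGroup W] [NormedSpace ℝ W]
    {f : OrientedLine V E → W}
    (hf : ∀ (O : E) (b : OrthonormalBasis (Fin 3) ℝ V),
      ContDiff ℝ ∞ fun y => f (through (framePos b y +ᵥ O) (frameUnit b y))) :
    ContMDiff (𝓡 4) 𝓘(ℝ, W) ∞ f := by
  intro ℓ
  have h1 : ContMDiffAt (𝓡 4) (𝓡 4) ∞ (chartAt (EuclideanSpace ℝ (Fin 4)) ℓ) ℓ :=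
    contMDiffAt_of_mem_maximalAtlas (IsManifold.chart_mem_maximalAtlas ℓ)
      (mem_chart_source _ ℓ)
  have h2 := (hf ℓ.point (exists_basis ℓ).choose).contMDiff.contMDiffAt.comp ℓ h1
  refine h2.congr_of_eventuallyEq ?_
  filter_upwards [(chartAt (EuclideanSpace ℝ (Fin 4)) ℓ).open_source.mem_nhds
    (mem_chart_source _ ℓ)] with ℓ' hℓ'
  exact congrArg f (through_frameCoord _ _ hℓ').symm

lemma contMDiff_dir : ContMDiff (𝓡 4) 𝓘(ℝ, V) ∞ (dir : OrientedLine V E → V) :=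
  contMDiff_of_frame fun _ b => contDiff_frameUnit b

lemma contMDiff_foot (O : E) : ContMDiff (𝓡 4) 𝓘(ℝ, V) ∞ (foot O : OrientedLine V E → V) :=
  contMDiff_of_frame fun O' b => contDiff_foot_frame O O' b

/-- The form `dP ∧ du` on the manifold of oriented lines:
`ω(ξ, η) = dP(ξ) · du(η) - dP(η) · du(ξ)`, where `u` is the unit directing vector
and `P` is the position relative to the origin `O` of a point of the line (here
the orthogonal projection of `O`). -/
def symplecticForm (O : E) (ℓ : OrientedLine V E) (ξ η : TangentSpace (𝓡 4) ℓ) : ℝ :=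
  inner ℝ (mvfderiv (𝓡 4) (foot O) ℓ ξ) (mvfderiv (𝓡 4) dir ℓ η) -
    inner ℝ (mvfderiv (𝓡 4) (foot O) ℓ η) (mvfderiv (𝓡 4) dir ℓ ξ)

lemma mdifferentiableAt_dir (ℓ : OrientedLine V E) :
    MDifferentiableAt (𝓡 4) 𝓘(ℝ, V) dir ℓ :=
  contMDiff_dir.mdifferentiableAt (by simp)

lemma mdifferentiableAt_foot (O : E) (ℓ : OrientedLine V E) :
    MDifferentiableAt (𝓡 4) 𝓘(ℝ, V) (foot O) ℓ :=
  (contMDiff_foot O).mdifferentiableAt (by simp)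

/-- A vector-valued function and its differential at `ℓ`, read in the chart at `ℓ`. -/
lemma mvfderiv_eq_fderiv {f : OrientedLine V E → V} {ℓ : OrientedLine V E}
    (hf : MDifferentiableAt (𝓡 4) 𝓘(ℝ, V) f ℓ) (ξ : TangentSpace (𝓡 4) ℓ) :
    mvfderiv (𝓡 4) f ℓ ξ =
      fderiv ℝ (f ∘ (extChartAt (𝓡 4) ℓ).symm) (extChartAt (𝓡 4) ℓ ℓ) ξ := by
  simp only [mvfderiv, mfderiv, hf, writtenInExtChartAt]
  simp
  rfl

lemma differentiableAt_dir_chart (ℓ : OrientedLine V E) (y : EuclideanSpace ℝ (Fin 4)) :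
    DifferentiableAt ℝ ((dir : OrientedLine V E → V) ∘ (extChartAt (𝓡 4) ℓ).symm) y :=
  (contDiff_frameUnit (exists_basis ℓ).choose).differentiable (by simp) y

lemma inner_dir_mvfderiv_dir (ℓ : OrientedLine V E) (ξ : TangentSpace (𝓡 4) ℓ) :
    inner ℝ ℓ.dir (mvfderiv (𝓡 4) dir ℓ ξ) = (0 : ℝ) := by
  have hd := differentiableAt_dir_chart ℓ (extChartAt (𝓡 4) ℓ ℓ)
  have h := fderiv_inner_apply ℝ hd hd ξ
  have hc : (fun t => (inner ℝ (((dir : OrientedLine V E → V) ∘ (extChartAt (𝓡 4) ℓ).symm) t)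
      (((dir : OrientedLine V E → V) ∘ (extChartAt (𝓡 4) ℓ).symm) t) : ℝ)) = fun _ => 1 := by
    funext t
    simp [norm_dir]
  rw [hc, ← mvfderiv_eq_fderiv (mdifferentiableAt_dir ℓ), fderiv_const_apply] at h
  simp only [Function.comp_apply, extChartAt_to_inv] at h
  rw [real_inner_comm ℓ.dir] at h
  change (0 : ℝ) = _ at h
  linarith

lemma mvfderiv_foot_origin (O O' : E) (ℓ : OrientedLine V E) (ξ : TangentSpace (𝓡 4) ℓ) :
    mvfderiv (𝓡 4) (foot O') ℓ ξ = mvfderiv (𝓡 4) (foot O) ℓ ξ -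
      ((inner ℝ (O -ᵥ O') ℓ.dir : ℝ) • mvfderiv (𝓡 4) dir ℓ ξ +
        (inner ℝ (O -ᵥ O') (mvfderiv (𝓡 4) dir ℓ ξ) : ℝ) • ℓ.dir) := by
  set B := (dir : OrientedLine V E → V) ∘ (extChartAt (𝓡 4) ℓ).symm with hB
  set A := (foot O : OrientedLine V E → V) ∘ (extChartAt (𝓡 4) ℓ).symm with hA
  set y := extChartAt (𝓡 4) ℓ ℓ with hy
  have hBd : HasFDerivAt B (fderiv ℝ B y) y := (differentiableAt_dir_chart ℓ y).hasFDerivAt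
  have hAd : HasFDerivAt A (fderiv ℝ A y) y := by
    refine DifferentiableAt.hasFDerivAt ?_
    have h := contDiff_foot_frame O ℓ.point (exists_basis ℓ).choose
    exact h.differentiable (by simp) y
  have hin : HasFDerivAt (fun z => (inner ℝ (O -ᵥ O') (B z) : ℝ))
      ((innerSL ℝ (O -ᵥ O')).comp (fderiv ℝ B y)) y :=
    (innerSL ℝ (O -ᵥ O')).hasFDerivAt.comp y hBd
  have hf : (foot O' : OrientedLine V E → V) ∘ (extChartAt (𝓡 4) ℓ).symm =
      fun z => A z + ((O -ᵥ O') - (inner ℝ (O -ᵥ O') (B z) : ℝ) • B z) := by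
    funext z
    exact foot_origin O O' _
  have hB0 : B y = ℓ.dir := by simp [hB, hy]
  have h := (hAd.add ((hin.smul hBd).const_sub (O -ᵥ O'))).fderiv
  rw [mvfderiv_eq_fderiv (mdifferentiableAt_foot O' ℓ), hf,
    mvfderiv_eq_fderiv (mdifferentiableAt_foot O ℓ),
    mvfderiv_eq_fderiv (mdifferentiableAt_dir ℓ), ← hB, ← hA, ← hy, ← hB0]
  refine (congrArg (fun D : EuclideanSpace ℝ (Fin 4) →L[ℝ] V => D ξ) h).trans ?_
  change fderiv ℝ A y ξ + -(((inner ℝ (O -ᵥ O') (B y) : ℝ) • fderiv ℝ B y ξ) +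
    (inner ℝ (O -ᵥ O') (fderiv ℝ B y ξ) : ℝ) • B y) = _
  rw [← sub_eq_add_neg]

/-- The form does not depend on the origin. -/
lemma symplecticForm_origin (O O' : E) (ℓ : OrientedLine V E) (ξ η : TangentSpace (𝓡 4) ℓ) :
    symplecticForm O' ℓ ξ η = symplecticForm O ℓ ξ η := by
  simp only [symplecticForm, mvfderiv_foot_origin O O', inner_sub_left, inner_add_left,
    inner_smul_left, inner_dir_mvfderiv_dir]
  rw [real_inner_comm (mvfderiv (𝓡 4) dir ℓ ξ) (mvfderiv (𝓡 4) dir ℓ η)]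
  simp

/-- The Liouville form `θ(ξ) = OP · du(ξ)`. -/
def liouvilleForm (O : E) (ℓ : OrientedLine V E) : TangentSpace (𝓡 4) ℓ →L[ℝ] ℝ :=
  (innerSL ℝ (foot O ℓ)).comp (mvfderiv (𝓡 4) dir ℓ)

/-- The form is the exterior derivative of the Liouville form, computed in the chart at `ℓ`. -/
lemma symplecticForm_eq_extDeriv (O : E) (ℓ : OrientedLine V E) (ξ η : TangentSpace (𝓡 4) ℓ)
    (θ : EuclideanSpace ℝ (Fin 4) → EuclideanSpace ℝ (Fin 4) →L[ℝ] ℝ)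
    (hθ : ∀ y, θ y = (liouvilleForm O ((extChartAt (𝓡 4) ℓ).symm y)).comp
      (mfderiv 𝓘(ℝ, EuclideanSpace ℝ (Fin 4)) (𝓡 4) (extChartAt (𝓡 4) ℓ).symm y)) :
    symplecticForm O ℓ ξ η =
      fderiv ℝ θ (extChartAt (𝓡 4) ℓ ℓ) ξ η - fderiv ℝ θ (extChartAt (𝓡 4) ℓ ℓ) η ξ := by
  set B := (dir : OrientedLine V E → V) ∘ (extChartAt (𝓡 4) ℓ).symm with hB
  set A := (foot O : OrientedLine V E → V) ∘ (extChartAt (𝓡 4) ℓ).symm with hA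
  set y := extChartAt (𝓡 4) ℓ ℓ with hy
  have hBs : ContDiff ℝ ∞ B := contDiff_frameUnit (exists_basis ℓ).choose
  have hAs : ContDiff ℝ ∞ A := contDiff_foot_frame O ℓ.point (exists_basis ℓ).choose
  have hθ' : θ = fun z => (innerSL ℝ (A z)).comp (fderiv ℝ B z) := by
    funext z
    have hsymm : MDifferentiableAt 𝓘(ℝ, EuclideanSpace ℝ (Fin 4)) (𝓡 4)
        (extChartAt (𝓡 4) ℓ).symm z := by
      refine ((contMDiffOn_extChartAt_symm (n := ∞) ℓ).contMDiffAt ?_).mdifferentiableAt (by simp)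
      have ht : (extChartAt (𝓡 4) ℓ).target = Set.univ := by
        rw [extChartAt_target]
        change _ ⁻¹' Set.univ ∩ _ = _
        simp
      rw [ht]
      exact Filter.univ_mem
    have hc := mfderiv_comp z (mdifferentiableAt_dir ((extChartAt (𝓡 4) ℓ).symm z)) hsymm
    rw [mfderiv_eq_fderiv] at hc
    rw [hθ z]
    ext w
    have hw := congrArg (fun D : EuclideanSpace ℝ (Fin 4) →L[ℝ] V => D w) hc
    exact congrArg (fun v : V => (inner ℝ (A z) v : ℝ)) hw.symm
  have hB1 : ContDiff ℝ 1 (fderiv ℝ B) := hBs.fderiv_right (by norm_cast)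
  have hA1 : ContDiff ℝ 1 A := hAs.of_le (by norm_cast)
  have hθd : DifferentiableAt ℝ θ y := by
    have : ContDiff ℝ 1 θ := by
      rw [contDiff_clm_apply_iff, hθ']
      exact fun w => hA1.inner ℝ (hB1.clm_apply contDiff_const)
    exact this.differentiable (by simp) y
  have hD : ∀ v w : EuclideanSpace ℝ (Fin 4), fderiv ℝ θ y v w =
      inner ℝ (A y) (fderiv ℝ (fderiv ℝ B) y v w) + inner ℝ (fderiv ℝ A y v) (fderiv ℝ B y w) := by
    intro v w
    have h1 : fderiv ℝ θ y v w = fderiv ℝ (fun z => θ z w) y v := by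
      rw [fderiv_clm_apply hθd (differentiableAt_const w)]
      simp
    have hBd : DifferentiableAt ℝ (fderiv ℝ B) y := hB1.differentiable (by simp) y
    have h2 : fderiv ℝ (fun z => fderiv ℝ B z w) y v = fderiv ℝ (fderiv ℝ B) y v w := by
      rw [fderiv_clm_apply hBd (differentiableAt_const w)]
      simp
    have h3 := fderiv_inner_apply ℝ (hA1.differentiable (by simp) y)
      (hBd.clm_apply (differentiableAt_const w)) v
    rw [h2] at h3
    rw [h1, ← h3, hθ']
    rfl
  have hsym : ∀ v w, fderiv ℝ (fderiv ℝ B) y v w = fderiv ℝ (fderiv ℝ B) y w v := fun v w =>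
    (hBs.contDiffAt (x := y)).isSymmSndFDerivAt (by simp; norm_cast) v w
  have key : ∀ v w : EuclideanSpace ℝ (Fin 4),
      (inner ℝ (fderiv ℝ A y v) (fderiv ℝ B y w) - inner ℝ (fderiv ℝ A y w) (fderiv ℝ B y v) : ℝ)
        = fderiv ℝ θ y v w - fderiv ℝ θ y w v := by
    intro v w
    rw [hD, hD, hsym v w]
    ring
  rw [symplecticForm, mvfderiv_eq_fderiv (mdifferentiableAt_foot O ℓ),
    mvfderiv_eq_fderiv (mdifferentiableAt_foot O ℓ),
    mvfderiv_eq_fderiv (mdifferentiableAt_dir ℓ), mvfderiv_eq_fderiv (mdifferentiableAt_dir ℓ)]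
  exact key ξ η

end OrientedLine

section Surfaces

variable {V E : Type*} [NormedAddCommGroup V] [InnerProductSpace ℝ V]
  [MetricSpace E] [NormedAddTorsor V E]

/-- `S` is a smooth (embedded) surface of the three-dimensional space `E`: near each of its
points it is the zero set of a smooth function whose differential does not vanish. -/
def IsSmoothSurface (S : Set E) : Prop :=
  ∀ p ∈ S, ∃ W : Set E, IsOpen W ∧ p ∈ W ∧ ∃ f : E → ℝ,
    (∀ q ∈ W, ContDiffAt ℝ ∞ (fun v : V => f (v +ᵥ q)) 0 ∧
      fderiv ℝ (fun v : V => f (v +ᵥ q)) 0 ≠ 0) ∧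
    ∀ q ∈ W, q ∈ S ↔ f q = 0

/-- The vectors tangent to `S` at `p`: the velocities at `p` of the smooth curves drawn on `S`. -/
def tangentVectors (S : Set E) (p : E) : Set V :=
  {v | ∃ γ : ℝ → E, γ 0 = p ∧ (∀ᶠ t in 𝓝 0, γ t ∈ S) ∧
    ContDiffAt ℝ ∞ (fun t => γ t -ᵥ p) 0 ∧ HasDerivAt (fun t => γ t -ᵥ p) v 0}

/-- The line `ℓ` crosses the surface `S` orthogonally: it meets `S`, and at each point where
it meets `S` its direction is orthogonal to the tangent plane. -/
def OrientedLine.CrossesOrthogonally (ℓ : OrientedLine V E) (S : Set E) : Prop :=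
  (∃ p ∈ S, p ∈ ℓ) ∧ ∀ p ∈ S, p ∈ ℓ → ∀ v ∈ tangentVectors S p, inner ℝ v ℓ.dir = (0 : ℝ)

end Surfaces

section Families

variable {V E : Type*} [NormedAddCommGroup V] [InnerProductSpace ℝ V]
  [MetricSpace E] [NormedAddTorsor V E]
  {F : Type*} [TopologicalSpace F] [ChartedSpace (EuclideanSpace ℝ (Fin 2)) F]

/-- `m₀` is a regular point of the ray `L x₀` in the family `L`: for every smooth surface `S`
containing `m₀` and transverse to the ray at `m₀` there are open neighbourhoods `U` of `x₀` in
the family and `S ∩ W` of `m₀` in `S` such that each ray of `U` meets `S ∩ W` in a unique point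
`m x`, and `m` is a diffeomorphism of `U` onto `S ∩ W`, with inverse `g`. -/
def IsRegularPoint (L : F → OrientedLine V E) (x₀ : F) (m₀ : E) : Prop :=
  m₀ ∈ L x₀ ∧ ∀ S : Set E, IsSmoothSurface S → m₀ ∈ S → (L x₀).dir ∉ tangentVectors S m₀ →
    ∃ U : Set F, IsOpen U ∧ x₀ ∈ U ∧ ∃ W : Set E, IsOpen W ∧ m₀ ∈ W ∧
      ∃ (m : F → E) (g : E → F),
        (∀ x ∈ U, ∀ p, (p ∈ S ∩ W ∧ p ∈ L x) ↔ p = m x) ∧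
        (∀ x ∈ U, g (m x) = x) ∧ (∀ p ∈ S ∩ W, g p ∈ U ∧ m (g p) = p) ∧
        ContMDiffOn (𝓡 2) 𝓘(ℝ, V) ∞ (fun x => m x -ᵥ m₀) U ∧
        ContMDiffOn 𝓘(ℝ, V) (𝓡 2) ∞ (fun v : V => g (v +ᵥ m₀)) {v | v +ᵥ m₀ ∈ S ∩ W}

/-- The family is rectangular: through each regular point of each ray there is a smooth surface
orthogonally crossed by the ray and by all the rays in a neighbourhood of it in the family. -/
def IsRectangular (L : F → OrientedLine V E) : Prop :=
  ∀ x₀ m₀, IsRegularPoint L x₀ m₀ → ∃ S : Set E, IsSmoothSurface S ∧ m₀ ∈ S ∧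
    ∃ U : Set F, IsOpen U ∧ x₀ ∈ U ∧ ∀ x ∈ U, (L x).CrossesOrthogonally S

/-- The family is Lagrangian for the symplectic form: the form vanishes on it, and its dimension
is half the dimension of the manifold of oriented lines. -/
def IsLagrangian [Fact (Module.finrank ℝ V = 3)] (O : E) (L : F → OrientedLine V E) : Prop :=
  ∀ x : F,
    (∀ ξ η : TangentSpace (𝓡 2) x, OrientedLine.symplecticForm O (L x)
      (mfderiv (𝓡 2) (𝓡 4) L x ξ) (mfderiv (𝓡 2) (𝓡 4) L x η) = 0) ∧
    2 * Module.finrank ℝ (TangentSpace (𝓡 2) x) = Module.finrank ℝ (TangentSpace (𝓡 4) (L x))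

end Families

end

/-! In a chart of the family pick a point `Q z` on each ray and let `u z` be its unit direction.
Since `u · du = 0`, sliding the points along the rays does not change `dQ ∧ du`, so this form is the
pull-back of the symplectic form whatever the choice of `Q` (`wedge_add_smul`, `wedge_foot_eq`). It
is also the exterior derivative of `θ = -u · dQ`. The points `N = Q + s u` satisfy `dN · u = dQ · u
+ ds`, so their displacements are orthogonal to the rays exactly when `ds = θ`. Being Lagrangian is
therefore the integrability condition for a surface orthogonal to the rays.

Lagrangian implies rectangular: apply regularity of `m₀` to the plane through `m₀` orthogonal to its
ray. This gives an immersed `Q` with `Q z₀` at `m₀` and `dQ · u = 0` at `z₀`. The Poincaré lemma on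
a ball yields `s` with `s z₀ = 0` (`exists_orthogonal_displacement`). Then `N` has the same
differential as `Q` at `z₀`, so it is an immersion there. The map `(z, τ) ↦ N z + τ u z` is a local
diffeomorphism at `(z₀, 0)`, and its slice `τ = 0` is the required surface
(`exists_surface_of_orthogonal_displacement`).

Rectangular implies Lagrangian: an orthogonal surface is transverse to the ray, so regularity of
`m₀` applies to that surface and makes the intersection point `m x` smooth in `x`. Its displacements
are tangent to the surface, hence orthogonal to the rays, and differentiating `dm · u = 0` gives `dm
∧ du = 0` (`wedge_eq_zero_of_orthogonal`). -/

/-! ### Calculus of the form `dQ ∧ du` in a vector space of parameters -/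

section Calculus

variable {G : Type*} [NormedAddCommGroup G] [NormedSpace ℝ G]
  {V : Type*} [NormedAddCommGroup V] [InnerProductSpace ℝ V]

/-- The local inverse of a smooth map is smooth at all points of its domain. -/
lemma exists_openPartialHomeomorph_contDiffAt_symm {H : Type*} [NormedAddCommGroup H]
    [NormedSpace ℝ H] [CompleteSpace G] {Φ : G → H} {Ω : Set G} (hΩ : IsOpen Ω)
    (hΦ : ContDiffOn ℝ ∞ Φ Ω) {x : G} (hx : x ∈ Ω) (A : G ≃L[ℝ] H)
    (hA : HasFDerivAt Φ (A : G →L[ℝ] H) x) :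
    ∃ e : OpenPartialHomeomorph G H, (e : G → H) = Φ ∧ x ∈ e.source ∧ e.source ⊆ Ω ∧
      ∀ p ∈ e.target, ContDiffAt ℝ ∞ e.symm p := by
  have hat : ∀ z ∈ Ω, ContDiffAt ℝ ∞ Φ z := fun z hz => hΦ.contDiffAt (hΩ.mem_nhds hz)
  have hcont : ContinuousAt (fderiv ℝ Φ) x :=
    ((hat x hx).fderiv_right (m := 0) (by simp)).continuousAt
  -- Invertible operators form an open set, so the derivative stays invertible near `x`. Restricting
  -- to such a neighbourhood makes the inverse smooth at every point of its domain, not only at `Φ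
  -- x`.
  have hev : ∀ᶠ z in 𝓝 x, z ∈ Ω ∧ fderiv ℝ Φ z ∈ Set.range ((↑) : (G ≃L[ℝ] H) → G →L[ℝ] H) := by
    refine Filter.Eventually.and (hΩ.mem_nhds hx) (hcont.eventually ?_)
    rw [hA.fderiv]
    exact A.nhds
  obtain ⟨T, hT, hTo, hxT⟩ := eventually_nhds_iff.mp hev
  set e := ((hat x hx).toOpenPartialHomeomorph Φ hA (by simp)).restrOpen T hTo with he
  have hcoe : (e : G → H) = Φ := rfl
  have hsub : ∀ z ∈ e.source, z ∈ T := fun z hz => hz.2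
  refine ⟨e, hcoe, ⟨(hat x hx).mem_toOpenPartialHomeomorph_source hA (by simp), hxT⟩,
    fun z hz => (hT z (hsub z hz)).1, fun p hp => ?_⟩
  have hz := e.map_target hp
  obtain ⟨h1, B, hB⟩ := hT _ (hsub _ hz)
  refine e.contDiffAt_symm (f₀' := B) hp ?_ (hat _ h1)
  rw [hB]
  exact ((hat _ h1).differentiableAt (by simp)).hasFDerivAt

/-- The derivative of a field of unit vectors is orthogonal to it. -/
lemma inner_fderiv_of_norm_eq_one {u : G → V} {z : G} (hu : DifferentiableAt ℝ u z)
    (hn : ∀ᶠ y in 𝓝 z, ‖u y‖ = 1) (c : G) : inner ℝ (u z) (fderiv ℝ u z c) = (0 : ℝ) := by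
  have h := fderiv_inner_apply ℝ hu hu c
  have hc : (fun y => (inner ℝ (u y) (u y) : ℝ)) =ᶠ[𝓝 z] fun _ => 1 := by
    filter_upwards [hn] with y hy
    simp [hy]
  rw [hc.fderiv_eq, fderiv_const_apply, real_inner_comm (u z)] at h
  change (0 : ℝ) = _ at h
  linarith

/-- Moving the points along the lines does not change the form `dQ ∧ du`. -/
lemma wedge_add_smul {Q u : G → V} {t : G → ℝ} {z : G} (hQ : DifferentiableAt ℝ Q z)
    (hu : DifferentiableAt ℝ u z) (ht : DifferentiableAt ℝ t z)
    (hn : ∀ᶠ y in 𝓝 z, ‖u y‖ = 1) (a b : G) :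
    (inner ℝ (fderiv ℝ (fun y => Q y + t y • u y) z a) (fderiv ℝ u z b) -
      inner ℝ (fderiv ℝ (fun y => Q y + t y • u y) z b) (fderiv ℝ u z a) : ℝ) =
    inner ℝ (fderiv ℝ Q z a) (fderiv ℝ u z b) - inner ℝ (fderiv ℝ Q z b) (fderiv ℝ u z a) := by
  have hz : ∀ c, inner ℝ (u z) (fderiv ℝ u z c) = (0 : ℝ) := inner_fderiv_of_norm_eq_one hu hn
  have hd : HasFDerivAt (fun y => Q y + t y • u y) _ z :=
    hQ.hasFDerivAt.add (ht.hasFDerivAt.smul hu.hasFDerivAt)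
  -- The new terms are `dt(a) u · du(b)`, which vanish because `u ⟂ du`, and `t du(a) · du(b)`,
  -- which is symmetric in `a`, `b` and cancels.
  rw [hd.fderiv]
  simp [inner_add_left, inner_smul_left, hz]
  rw [real_inner_comm (fderiv ℝ u z a) (fderiv ℝ u z b)]
  ring

/-- If `dQ ∧ du = 0`, then the points `Q` can be moved along the lines so that their
displacements become orthogonal to the lines. -/
lemma exists_orthogonal_displacement {Q u : G → V} {Ω : Set G} (hΩ : IsOpen Ω) {z₀ : G}
    (hz₀ : z₀ ∈ Ω) (hQ : ContDiffOn ℝ ∞ Q Ω) (hu : ContDiffOn ℝ ∞ u Ω) (hn : ∀ z ∈ Ω, ‖u z‖ = 1)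
    (hω : ∀ z ∈ Ω, ∀ a b, (inner ℝ (fderiv ℝ Q z a) (fderiv ℝ u z b) -
      inner ℝ (fderiv ℝ Q z b) (fderiv ℝ u z a) : ℝ) = 0)
    (hz : ∀ a, inner ℝ (fderiv ℝ Q z₀ a) (u z₀) = (0 : ℝ)) :
    ∃ Ω' ⊆ Ω, IsOpen Ω' ∧ z₀ ∈ Ω' ∧ ∃ s : G → ℝ, ContDiffOn ℝ ∞ s Ω' ∧ s z₀ = 0 ∧
      (∀ z ∈ Ω', ∀ a, inner ℝ (fderiv ℝ (fun y => Q y + s y • u y) z a) (u z) = (0 : ℝ)) ∧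
      fderiv ℝ (fun y => Q y + s y • u y) z₀ = fderiv ℝ Q z₀ := by
  obtain ⟨r, hr, hball⟩ := Metric.isOpen_iff.mp hΩ z₀ hz₀
  -- The sign makes `ds = θ` equivalent to `d(Q + s u) · u = 0`.
  set θ : G → G →L[ℝ] ℝ := fun z => -(innerSL ℝ (u z)).comp (fderiv ℝ Q z) with hθ
  have hQ1 : ContDiffOn ℝ ∞ (fderiv ℝ Q) Ω := hQ.fderiv_of_isOpen hΩ (by simp)
  have hθs : ContDiffOn ℝ ∞ θ Ω :=
    (((innerSL ℝ).contDiff.comp_contDiffOn hu).clm_comp hQ1).neg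
  have hQd : ∀ z ∈ Ω, DifferentiableAt ℝ Q z := fun z hz =>
    (hQ.contDiffAt (hΩ.mem_nhds hz)).differentiableAt (by simp)
  have hud : ∀ z ∈ Ω, DifferentiableAt ℝ u z := fun z hz =>
    (hu.contDiffAt (hΩ.mem_nhds hz)).differentiableAt (by simp)
  have hQ1d : ∀ z ∈ Ω, DifferentiableAt ℝ (fderiv ℝ Q) z := fun z hz =>
    (hQ1.contDiffAt (hΩ.mem_nhds hz)).differentiableAt (by simp)
  have hθd : ∀ z ∈ Ω, DifferentiableAt ℝ θ z := fun z hz =>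
    (hθs.contDiffAt (hΩ.mem_nhds hz)).differentiableAt (by simp)
  -- Closedness of `θ`: the second derivative of `Q` is symmetric, so the antisymmetric part of `dθ`
  -- is just `dQ ∧ du`.
  have hsymm : ∀ z ∈ Ω, ∀ a b, fderiv ℝ θ z a b = fderiv ℝ θ z b a := by
    have key : ∀ z ∈ Ω, ∀ a b, fderiv ℝ θ z a b =
        -(inner ℝ (u z) (fderiv ℝ (fderiv ℝ Q) z a b) +
          inner ℝ (fderiv ℝ u z a) (fderiv ℝ Q z b)) := by
      intro z hz a b
      have h1 : fderiv ℝ θ z a b = fderiv ℝ (fun y => θ y b) z a := by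
        rw [fderiv_clm_apply (hθd z hz) (differentiableAt_const b)]
        simp
      have h2 : fderiv ℝ (fun y => fderiv ℝ Q y b) z a = fderiv ℝ (fderiv ℝ Q) z a b := by
        rw [fderiv_clm_apply (hQ1d z hz) (differentiableAt_const b)]
        simp
      have h3 := fderiv_inner_apply ℝ (hud z hz)
        ((hQ1d z hz).clm_apply (differentiableAt_const b)) a
      rw [h2] at h3
      rw [h1, ← h3]
      have h4 : (fun y => θ y b) = -fun y => (inner ℝ (u y) (fderiv ℝ Q y b) : ℝ) := rfl
      rw [h4, fderiv_neg]
      rfl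
    intro z hz a b
    have hs : fderiv ℝ (fderiv ℝ Q) z a b = fderiv ℝ (fderiv ℝ Q) z b a :=
      (hQ.contDiffAt (hΩ.mem_nhds hz)).isSymmSndFDerivAt (by simp; norm_cast) a b
    rw [key z hz, key z hz, hs, real_inner_comm (fderiv ℝ Q z b), real_inner_comm (fderiv ℝ Q z a)]
    linarith [hω z hz a b]
  -- Poincaré lemma on a ball. The primitive is then normalised by subtracting its value at `z₀`, so
  -- that the point over `z₀` does not move.
  obtain ⟨s, hs⟩ := (convex_ball z₀ r).exists_forall_hasFDerivAt_of_fderiv_symmetric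
    Metric.isOpen_ball (fun z hz => (hθd z (hball hz)).differentiableWithinAt)
    (fun z hz => hsymm z (hball hz))
  have hs' : ∀ z ∈ Metric.ball z₀ r, HasFDerivAt (fun y => s y - s z₀) (θ z) z := fun z hz =>
    (hs z hz).sub_const _
  have hd : ∀ z ∈ Metric.ball z₀ r, HasFDerivAt (fun y => Q y + (s y - s z₀) • u y)
      (fderiv ℝ Q z + ((s z - s z₀) • fderiv ℝ u z + (θ z).smulRight (u z))) z := fun z hz =>
    (hQd z (hball hz)).hasFDerivAt.add ((hs' z hz).smul (hud z (hball hz)).hasFDerivAt)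
  refine ⟨Metric.ball z₀ r, hball, Metric.isOpen_ball, Metric.mem_ball_self hr,
    fun y => s y - s z₀, ?_, sub_self _, ?_, ?_⟩
  · rw [contDiffOn_infty_iff_fderiv_of_isOpen Metric.isOpen_ball]
    exact ⟨fun z hz => (hs' z hz).differentiableAt.differentiableWithinAt,
      (hθs.mono hball).congr fun z hz => (hs' z hz).fderiv⟩
  · intro z hz a
    have hu0 : inner ℝ (fderiv ℝ u z a) (u z) = (0 : ℝ) := by
      rw [real_inner_comm]
      refine inner_fderiv_of_norm_eq_one (hud z (hball hz)) ?_ a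
      filter_upwards [hΩ.mem_nhds (hball hz)] with y hy using hn y hy
    rw [(hd z hz).fderiv]
    simp [hθ, inner_add_left, inner_smul_left, hu0, hn z (hball hz)]
    rw [real_inner_comm]
    ring
  -- At `z₀` both corrections to `dQ` vanish: `s du` by the normalisation, and `ds · u` because `θ
  -- z₀ = 0` by `hz`.
  · rw [(hd z₀ (Metric.mem_ball_self hr)).fderiv]
    ext a
    have h : inner ℝ (u z₀) (fderiv ℝ Q z₀ a) = (0 : ℝ) := by rw [real_inner_comm]; exact hz a
    simp [hθ, h]

/-- If the displacements of the points `Q` are orthogonal to the lines, then `dQ ∧ du = 0`. -/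
lemma wedge_eq_zero_of_orthogonal {Q u : G → V} {z : G} (hQ : ContDiffAt ℝ ∞ Q z)
    (hu : ContDiffAt ℝ ∞ u z)
    (h : ∀ᶠ y in 𝓝 z, ∀ a, inner ℝ (fderiv ℝ Q y a) (u y) = (0 : ℝ)) (a b : G) :
    (inner ℝ (fderiv ℝ Q z a) (fderiv ℝ u z b) -
      inner ℝ (fderiv ℝ Q z b) (fderiv ℝ u z a) : ℝ) = 0 := by
  have hQ1 : DifferentiableAt ℝ (fderiv ℝ Q) z :=
    (hQ.fderiv_right (m := 1) (by norm_cast)).differentiableAt (by simp)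
  -- Differentiate `dQ(a) · u = 0` in the direction `b`. Exchanging `a` and `b` and subtracting
  -- eliminates the symmetric second derivative.
  have key : ∀ a b, inner ℝ (fderiv ℝ Q z a) (fderiv ℝ u z b) +
      inner ℝ (fderiv ℝ (fderiv ℝ Q) z b a) (u z) = (0 : ℝ) := by
    intro a b
    have h2 : fderiv ℝ (fun y => fderiv ℝ Q y a) z b = fderiv ℝ (fderiv ℝ Q) z b a := by
      rw [fderiv_clm_apply hQ1 (differentiableAt_const a)]
      simp
    have h3 := fderiv_inner_apply ℝ (hQ1.clm_apply (differentiableAt_const a))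
      (hu.differentiableAt (by simp)) b
    have hc : (fun y => (inner ℝ (fderiv ℝ Q y a) (u y) : ℝ)) =ᶠ[𝓝 z] fun _ => 0 := by
      filter_upwards [h] with y hy using hy a
    rw [hc.fderiv_eq, fderiv_const_apply, h2] at h3
    exact h3.symm
  have hs : fderiv ℝ (fderiv ℝ Q) z a b = fderiv ℝ (fderiv ℝ Q) z b a :=
    hQ.isSymmSndFDerivAt (by simp; norm_cast) a b
  have h1 := key a b
  have h2 := key b a
  rw [hs] at h2
  linarith

end Calculus

/-! ### Construction of a surface orthogonal to a family of lines -/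

section SurfaceConstruction

variable {G : Type*} [NormedAddCommGroup G] [NormedSpace ℝ G]
  {V E : Type*} [NormedAddCommGroup V] [InnerProductSpace ℝ V]
  [MetricSpace E] [NormedAddTorsor V E]

/-- The plane through `m₀` orthogonal to `w ≠ 0` is a smooth surface. -/
lemma isSmoothSurface_plane (m₀ : E) {w : V} (hw : w ≠ 0) :
    IsSmoothSurface (V := V) {q : E | (inner ℝ w (q -ᵥ m₀) : ℝ) = 0} := by
  refine fun p _ => ⟨Set.univ, isOpen_univ, Set.mem_univ _, fun q => inner ℝ w (q -ᵥ m₀),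
    fun q _ => ?_, fun q _ => Iff.rfl⟩
  have h : (fun v : V => (inner ℝ w ((v +ᵥ q) -ᵥ m₀) : ℝ)) =
      fun v => innerSL ℝ w v + inner ℝ w (q -ᵥ m₀) := by
    funext v
    rw [vadd_vsub_assoc, inner_add_right]
    rfl
  refine ⟨?_, ?_⟩
  · rw [h]
    exact (innerSL ℝ w).contDiff.contDiffAt.add contDiffAt_const
  · rw [h, ((innerSL ℝ w).hasFDerivAt.add_const _).fderiv]
    intro h0
    have h1 := congrArg (fun D : V →L[ℝ] ℝ => D w) h0
    simp at h1
    exact hw h1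

/-- The vectors tangent to a plane are orthogonal to its normal. -/
lemma inner_eq_zero_of_mem_tangentVectors_plane {m₀ p : E} {w v : V}
    (hv : v ∈ tangentVectors {q : E | (inner ℝ w (q -ᵥ m₀) : ℝ) = 0} p) :
    inner ℝ w v = (0 : ℝ) := by
  obtain ⟨γ, hγ0, hγS, -, hγd⟩ := hv
  have h1 : HasDerivAt (fun t => (inner ℝ w (γ t -ᵥ p) : ℝ)) (inner ℝ w v) 0 :=
    (innerSL ℝ w).hasFDerivAt.comp_hasDerivAt 0 hγd
  have hp : (inner ℝ w (p -ᵥ m₀) : ℝ) = 0 := by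
    have := hγS.self_of_nhds
    rwa [hγ0] at this
  have h2 : (fun t => (inner ℝ w (γ t -ᵥ p) : ℝ)) =ᶠ[𝓝 0] fun _ => 0 := by
    filter_upwards [hγS] with t ht
    have ht' : (inner ℝ w (γ t -ᵥ m₀) : ℝ) = 0 := ht
    rw [← vsub_sub_vsub_cancel_right (γ t) p m₀, inner_sub_right, ht', hp, sub_zero]
  exact h1.unique ((hasDerivAt_const _ _).congr_of_eventuallyEq h2)

/-- If the points `N` describe a surface with displacements orthogonal to the lines with
directions `u`, then these lines cross a smooth surface orthogonally. -/
lemma exists_surface_of_orthogonal_displacement [FiniteDimensional ℝ G] [FiniteDimensional ℝ V]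
    (hdim : Module.finrank ℝ V = Module.finrank ℝ G + 1) (O : E) {N u : G → V} {Ω : Set G}
    (hΩ : IsOpen Ω) {z₀ : G} (hz₀ : z₀ ∈ Ω) (hN : ContDiffOn ℝ ∞ N Ω) (hu : ContDiffOn ℝ ∞ u Ω)
    (hn : ∀ z ∈ Ω, ‖u z‖ = 1) (horth : ∀ z ∈ Ω, ∀ a, inner ℝ (fderiv ℝ N z a) (u z) = (0 : ℝ))
    (hinj : Function.Injective (fderiv ℝ N z₀)) :
    ∃ S : Set E, IsSmoothSurface (V := V) S ∧ N z₀ +ᵥ O ∈ S ∧ ∃ Ω' ⊆ Ω, IsOpen Ω' ∧ z₀ ∈ Ω' ∧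
      ∀ z ∈ Ω', N z +ᵥ O ∈ S ∧ ∀ τ : ℝ, (N z + τ • u z) +ᵥ O ∈ S →
        ∀ v ∈ tangentVectors S ((N z + τ • u z) +ᵥ O), inner ℝ v (u z) = (0 : ℝ) := by
  have hNd : ∀ z ∈ Ω, DifferentiableAt ℝ N z := fun z hz =>
    (hN.contDiffAt (hΩ.mem_nhds hz)).differentiableAt (by simp)
  have hud : ∀ z ∈ Ω, DifferentiableAt ℝ u z := fun z hz =>
    (hu.contDiffAt (hΩ.mem_nhds hz)).differentiableAt (by simp)
  -- Coordinates adapted to the lines: `z` labels the line and `τ` is the signed distance from `N z`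
  -- along it.
  set Φ : G × ℝ → V := fun x => N x.1 + x.2 • u x.1 with hΦ
  have hmaps : Set.MapsTo (Prod.fst : G × ℝ → G) (Ω ×ˢ Set.univ) Ω := fun x hx => hx.1
  have hΦs : ContDiffOn ℝ ∞ Φ (Ω ×ˢ Set.univ) :=
    (hN.comp contDiffOn_fst hmaps).add (contDiffOn_snd.smul (hu.comp contDiffOn_fst hmaps))
  have hΦd : HasFDerivAt Φ ((fderiv ℝ N z₀).comp (ContinuousLinearMap.fst ℝ G ℝ) +
      ((0 : ℝ) • (fderiv ℝ u z₀).comp (ContinuousLinearMap.fst ℝ G ℝ) +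
        (ContinuousLinearMap.snd ℝ G ℝ).smulRight (u z₀))) (z₀, 0) := by
    have h1 : HasFDerivAt (fun x : G × ℝ => N x.1) _ (z₀, (0 : ℝ)) :=
      HasFDerivAt.comp (z₀, (0 : ℝ)) (g := N) (hNd z₀ hz₀).hasFDerivAt hasFDerivAt_fst
    have h2 : HasFDerivAt (fun x : G × ℝ => u x.1) _ (z₀, (0 : ℝ)) :=
      HasFDerivAt.comp (z₀, (0 : ℝ)) (g := u) (hud z₀ hz₀).hasFDerivAt hasFDerivAt_fst
    exact h1.add (hasFDerivAt_snd.smul h2)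
  set D := (fderiv ℝ N z₀).comp (ContinuousLinearMap.fst ℝ G ℝ) +
      ((0 : ℝ) • (fderiv ℝ u z₀).comp (ContinuousLinearMap.fst ℝ G ℝ) +
        (ContinuousLinearMap.snd ℝ G ℝ).smulRight (u z₀)) with hD
  have hDinj : Function.Injective D := by
    rw [injective_iff_map_eq_zero]
    rintro ⟨a, c⟩ hac
    have hac' : fderiv ℝ N z₀ a + c • u z₀ = 0 := by simpa [hD] using hac
    have hc : c = 0 := by
      -- The component along `u z₀` isolates `c`, because the range of `dN` is orthogonal to it.
      have := congrArg (fun v : V => (inner ℝ v (u z₀) : ℝ)) hac'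
      simpa [inner_add_left, inner_smul_left, horth z₀ hz₀ a, hn z₀ hz₀] using this
    have ha : fderiv ℝ N z₀ a = 0 := by simpa [hc] using hac'
    rw [(injective_iff_map_eq_zero _).mp hinj a ha, hc]
    rfl
  have hfin : Module.finrank ℝ (G × ℝ) = Module.finrank ℝ V := by
    rw [Module.finrank_prod, Module.finrank_self, hdim]
  let A : (G × ℝ) ≃L[ℝ] V :=
    (LinearEquiv.ofInjectiveOfFinrankEq (D : G × ℝ →ₗ[ℝ] V) hDinj hfin).toContinuousLinearEquiv
  have hA : (A : G × ℝ →L[ℝ] V) = D := by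
    ext x <;> rfl
  have : CompleteSpace (G × ℝ) := FiniteDimensional.complete ℝ _
  obtain ⟨e, heΦ, hmem, hsub, hsymm⟩ := exists_openPartialHomeomorph_contDiffAt_symm
    (hΩ.prod isOpen_univ) hΦs (x := (z₀, 0)) ⟨hz₀, trivial⟩ A (by rw [hA]; exact hΦd)
  obtain ⟨ε, hε, hbox⟩ := Metric.isOpen_iff.mp e.open_source _ hmem
  obtain ⟨δ, hδ, hδε⟩ := Metric.continuousAt_iff.mp (hNd z₀ hz₀).continuousAt (ε / 2) (by positivity)
  -- The radius serves two purposes: `B × (-ε, ε)` lies in the domain of the local inverse, and any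
  -- two points of `N(B)` are less than `ε` apart. The second bound controls every point where a
  -- line meets the surface, not just `N z`.
  set B := Metric.ball z₀ (min δ ε) with hB
  have hBbox : ∀ z ∈ B, ∀ τ : ℝ, |τ| < ε → (z, τ) ∈ e.source := by
    intro z hz τ hτ
    refine hbox ?_
    rw [Metric.mem_ball, Prod.dist_eq, max_lt_iff]
    refine ⟨lt_of_lt_of_le hz (min_le_right _ _), ?_⟩
    simpa using hτ
  have hB0 : ∀ z ∈ B, (z, (0 : ℝ)) ∈ e.source := fun z hz => hBbox z hz 0 (by simpa using hε)
  have hBΩ : B ⊆ Ω := fun z hz => (hsub (hB0 z hz)).1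
  have hBN : ∀ z ∈ B, ∀ z' ∈ B, ‖N z - N z'‖ < ε := by
    intro z hz z' hz'
    rw [← dist_eq_norm]
    have h1 := hδε (lt_of_lt_of_le hz (min_le_left _ _))
    have h2 := hδε (lt_of_lt_of_le hz' (min_le_left _ _))
    calc dist (N z) (N z') ≤ dist (N z) (N z₀) + dist (N z') (N z₀) := dist_triangle_right _ _ _
      _ < ε := by linarith
  have hz₀B : z₀ ∈ B := Metric.mem_ball_self (by positivity)
  set e' := e.restrOpen (B ×ˢ Set.univ) (Metric.isOpen_ball.prod isOpen_univ) with he'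
  have he'Φ : ∀ x, e' x = Φ x := fun x => congrFun heΦ x
  have hsymm' : ∀ p ∈ e'.target, ContDiffAt ℝ ∞ e'.symm p := fun p hp => hsymm p hp.1
  have hsrc : ∀ x, x ∈ e'.source ↔ x ∈ e.source ∧ x.1 ∈ B := fun x => by
    simp [he']
  -- The surface is the zero set of the coordinate `τ`, and by `hNS` and `hSN` it is the image of
  -- `B` under `N`.
  set S : Set E := {p | p -ᵥ O ∈ e'.target ∧ (e'.symm (p -ᵥ O)).2 = 0} with hS
  have hNS : ∀ z ∈ B, N z +ᵥ O ∈ S := by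
    intro z hz
    have h1 : (z, (0 : ℝ)) ∈ e'.source := (hsrc _).mpr ⟨hB0 z hz, hz⟩
    have h2 : e' (z, (0 : ℝ)) = N z := by rw [he'Φ]; simp [hΦ]
    have h3 : (N z +ᵥ O) -ᵥ O = e' (z, (0 : ℝ)) := by rw [h2, vadd_vsub]
    refine ⟨?_, ?_⟩
    · rw [h3]
      exact e'.map_source h1
    · rw [h3, e'.left_inv h1]
  have hSN : ∀ p ∈ S, (e'.symm (p -ᵥ O)).1 ∈ B ∧ p -ᵥ O = N (e'.symm (p -ᵥ O)).1 := by
    intro p hp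
    refine ⟨((hsrc _).mp (e'.map_target hp.1)).2, ?_⟩
    conv_lhs => rw [← e'.right_inv hp.1, he'Φ]
    simp [hΦ, hp.2]
  refine ⟨S, ?_, hNS z₀ hz₀B, B, hBΩ, Metric.isOpen_ball, hz₀B, fun z hz => ⟨hNS z hz, ?_⟩⟩
  · intro p hp
    refine ⟨{q | q -ᵥ O ∈ e'.target}, ?_, hp.1, fun q => (e'.symm (q -ᵥ O)).2, fun q hq => ?_,
      fun q hq => ⟨fun h => h.2, fun h => ⟨hq, h⟩⟩⟩
    · exact e'.open_target.preimage (continuous_id.vsub continuous_const)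
    have hq' : q -ᵥ O ∈ e'.target := hq
    have hc : ContDiffAt ℝ ∞ (fun v : V => (e'.symm ((v +ᵥ q) -ᵥ O)).2) 0 := by
      have h1 : ContDiffAt ℝ ∞ (fun v : V => (e'.symm v).2) (0 + (q -ᵥ O)) := by
        rw [zero_add]
        exact (hsymm' _ hq').snd
      have h2 := h1.comp (0 : V) (f := fun v : V => v + (q -ᵥ O))
        (contDiffAt_id.add contDiffAt_const)
      simpa only [vadd_vsub_assoc] using! h2
    refine ⟨hc, fun h0 => ?_⟩
    set x := e'.symm (q -ᵥ O) with hx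
    have hxs : x ∈ e'.source := e'.map_target hq'
    have hline : HasDerivAt (fun h : ℝ => h • u x.1) (u x.1) 0 := by
      simpa using (hasDerivAt_id (0 : ℝ)).smul_const (u x.1)
    have hd := (hc.differentiableAt (by simp)).hasFDerivAt
    -- If the differential of `τ` vanished at `q`, then `τ` would have zero derivative along the
    -- line through `q` with direction `u x.1`; but there it grows at unit rate (`hev`).
    rw [h0, ← zero_smul ℝ (u x.1)] at hd
    have hd' := hd.comp_hasDerivAt (0 : ℝ) hline
    have hev : (fun h : ℝ => (e'.symm ((h • u x.1 +ᵥ q) -ᵥ O)).2) =ᶠ[𝓝 0] fun h => x.2 + h := by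
      have hcx : ContinuousAt (fun h : ℝ => (x.1, x.2 + h)) 0 := by fun_prop
      have : ∀ᶠ h in 𝓝 (0 : ℝ), (x.1, x.2 + h) ∈ e'.source :=
        hcx.eventually_mem (e'.open_source.mem_nhds (by simpa using hxs))
      filter_upwards [this] with h hh
      have h1 : (h • u x.1 +ᵥ q) -ᵥ O = e' (x.1, x.2 + h) := by
        rw [vadd_vsub_assoc, ← e'.right_inv hq', ← hx, he'Φ, he'Φ]
        simp only [hΦ]
        module
      rw [h1, e'.left_inv hh]
    have h2 : HasDerivAt (fun h : ℝ => x.2 + h) 1 0 := (hasDerivAt_id (0 : ℝ)).const_add _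
    have h3 := (h2.congr_of_eventuallyEq hev).unique hd'
    simp at h3
  · intro τ hτ v hv
    set p := (N z + τ • u z) +ᵥ O with hp
    obtain ⟨hpB, hpN⟩ := hSN p hτ
    set x := e'.symm (p -ᵥ O) with hx
    have hpO : p -ᵥ O = N z + τ • u z := by rw [hp, vadd_vsub]
    -- A common point of the line and `S` is some `N x.1`, so `τ u z` is a difference of two points
    -- of `N(B)`. Hence `(z, τ)` lies in the domain where `Φ` is injective, which forces `x.1 = z`.
    have hτε : |τ| < ε := by
      have h1 : τ • u z = N x.1 - N z := by
        rw [← hpN, hpO]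
        abel
      have h2 := hBN x.1 hpB z hz
      rwa [← h1, norm_smul, hn z (hBΩ hz), mul_one, Real.norm_eq_abs] at h2
    have hxz : x = (z, τ) := by
      have h1 : (z, τ) ∈ e'.source := (hsrc _).mpr ⟨hBbox z hz τ hτε, hz⟩
      rw [hx, hpO, show N z + τ • u z = e' (z, τ) by rw [he'Φ], e'.left_inv h1]
    obtain ⟨γ, hγ0, hγS, -, hγd⟩ := hv
    have hes : DifferentiableAt ℝ (fun w : V => (e'.symm (w + (p -ᵥ O))).1) (γ 0 -ᵥ p) := by
      have h1 : DifferentiableAt ℝ (fun v : V => (e'.symm v).1) ((γ 0 -ᵥ p) + (p -ᵥ O)) := by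
        rw [hγ0, vsub_self, zero_add]
        exact ((hsymm' _ hτ.1).fst).differentiableAt (by simp)
      exact h1.comp _ (f := fun w : V => w + (p -ᵥ O)) (differentiableAt_id.add_const _)
    have hζ := hes.hasFDerivAt.comp_hasDerivAt (0 : ℝ) hγd
    have hζ0 : (e'.symm ((γ 0 -ᵥ p) + (p -ᵥ O))).1 = z := by
      rw [hγ0, vsub_self, zero_add, ← hx, hxz]
    have hNz : HasFDerivAt N (fderiv ℝ N z) (e'.symm ((γ 0 -ᵥ p) + (p -ᵥ O))).1 := by
      rw [hζ0]
      exact (hNd z (hBΩ hz)).hasFDerivAt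
    have hcomp := (HasFDerivAt.comp_hasDerivAt (0 : ℝ) (l := N) hNz hζ).sub_const (p -ᵥ O)
    -- A curve on `S` is `N` applied to its `z`-coordinate, so its velocity at `p` lies in the range
    -- of `dN` at `z`.
    have hev : (fun t => γ t -ᵥ p) =ᶠ[𝓝 0]
        fun t => N (e'.symm ((γ t -ᵥ p) + (p -ᵥ O))).1 - (p -ᵥ O) := by
      filter_upwards [hγS] with t ht
      rw [vsub_add_vsub_cancel, ← (hSN _ ht).2, vsub_sub_vsub_cancel_right]
    have hv' := hγd.unique (hcomp.congr_of_eventuallyEq hev)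
    rw [hv']
    exact horth z (hBΩ hz) _

end SurfaceConstruction

/-! ### The family and the symplectic form read in a chart -/

section ChartExpressions

variable {V E : Type*} [NormedAddCommGroup V] [InnerProductSpace ℝ V]
  [MetricSpace E] [NormedAddTorsor V E]
  {F : Type*} [TopologicalSpace F] [ChartedSpace (EuclideanSpace ℝ (Fin 2)) F]

/-- The part of the range of the chart at `x₀` over an open set `U` is open. -/
lemma isOpen_extChartAt_target_inter_preimage (x₀ : F) {U : Set F} (hU : IsOpen U) :
    IsOpen ((extChartAt (𝓡 2) x₀).target ∩ (extChartAt (𝓡 2) x₀).symm ⁻¹' U) :=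
  (continuousOn_extChartAt_symm x₀).isOpen_inter_preimage (isOpen_extChartAt_target x₀) hU

variable [IsManifold (𝓡 2) ∞ F]

/-- A smooth vector-valued function is smooth in a chart. -/
lemma contDiffOn_comp_extChartAt_symm (x₀ : F) {U : Set F} {f : F → V}
    (hf : ContMDiffOn (𝓡 2) 𝓘(ℝ, V) ∞ f U) :
    ContDiffOn ℝ ∞ (f ∘ (extChartAt (𝓡 2) x₀).symm)
      ((extChartAt (𝓡 2) x₀).target ∩ (extChartAt (𝓡 2) x₀).symm ⁻¹' U) := by
  rw [← contMDiffOn_iff_contDiffOn]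
  exact hf.comp ((contMDiffOn_extChartAt_symm x₀).mono Set.inter_subset_left) fun z hz => hz.2

/-- The derivative of the inverse of a chart is surjective. -/
lemma mfderiv_extChartAt_symm_surjective (x₀ : F) {z : EuclideanSpace ℝ (Fin 2)}
    (hz : z ∈ (extChartAt (𝓡 2) x₀).target) :
    Function.Surjective
      (mfderiv 𝓘(ℝ, EuclideanSpace ℝ (Fin 2)) (𝓡 2) (extChartAt (𝓡 2) x₀).symm z) := by
  have h := isInvertible_mfderivWithin_extChartAt_symm (I := 𝓡 2) hz
  simp only [modelWithCornersSelf_coe, Set.range_id, mfderivWithin_univ] at h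
  exact h.bijective.surjective

variable [Fact (Module.finrank ℝ V = 3)]

/-- The derivative in a chart of a smooth function of the lines of a smooth family. -/
lemma fderiv_comp_extChartAt_symm {L : F → OrientedLine V E} (hL : ContMDiff (𝓡 2) (𝓡 4) ∞ L)
    {f : OrientedLine V E → V} (hf : ContMDiff (𝓡 4) 𝓘(ℝ, V) ∞ f) (x₀ : F)
    {z : EuclideanSpace ℝ (Fin 2)} (hz : z ∈ (extChartAt (𝓡 2) x₀).target)
    (a : EuclideanSpace ℝ (Fin 2)) :
    fderiv ℝ (f ∘ L ∘ (extChartAt (𝓡 2) x₀).symm) z a =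
      mvfderiv (𝓡 4) f (L ((extChartAt (𝓡 2) x₀).symm z))
        (mfderiv (𝓡 2) (𝓡 4) L ((extChartAt (𝓡 2) x₀).symm z)
          (mfderiv 𝓘(ℝ, EuclideanSpace ℝ (Fin 2)) (𝓡 2) (extChartAt (𝓡 2) x₀).symm z a)) := by
  have hΨ : MDifferentiableAt 𝓘(ℝ, EuclideanSpace ℝ (Fin 2)) (𝓡 2)
      (extChartAt (𝓡 2) x₀).symm z :=
    ((contMDiffOn_extChartAt_symm (n := ∞) x₀).contMDiffAt
      (extChartAt_target_mem_nhds' hz)).mdifferentiableAt (by simp)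
  have hL' : MDifferentiableAt (𝓡 2) (𝓡 4) L ((extChartAt (𝓡 2) x₀).symm z) :=
    hL.mdifferentiableAt (by simp)
  have hf' : MDifferentiableAt (𝓡 4) 𝓘(ℝ, V) f (L ((extChartAt (𝓡 2) x₀).symm z)) :=
    hf.mdifferentiableAt (by simp)
  have h1 := mfderiv_comp z hf' (hL'.comp z hΨ)
  rw [mfderiv_comp z hL' hΨ, mfderiv_eq_fderiv] at h1
  exact congrArg (fun D : EuclideanSpace ℝ (Fin 2) →L[ℝ] V => D a) h1

/-- The pull-back of the symplectic form read in a chart. -/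
lemma symplecticForm_mfderiv_extChartAt_symm (O : E) {L : F → OrientedLine V E}
    (hL : ContMDiff (𝓡 2) (𝓡 4) ∞ L) (x₀ : F) {z : EuclideanSpace ℝ (Fin 2)}
    (hz : z ∈ (extChartAt (𝓡 2) x₀).target) (a b : EuclideanSpace ℝ (Fin 2)) :
    (inner ℝ (fderiv ℝ (OrientedLine.foot O ∘ L ∘ (extChartAt (𝓡 2) x₀).symm) z a)
        (fderiv ℝ (OrientedLine.dir ∘ L ∘ (extChartAt (𝓡 2) x₀).symm) z b) -
      inner ℝ (fderiv ℝ (OrientedLine.foot O ∘ L ∘ (extChartAt (𝓡 2) x₀).symm) z b)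
        (fderiv ℝ (OrientedLine.dir ∘ L ∘ (extChartAt (𝓡 2) x₀).symm) z a) : ℝ) =
    OrientedLine.symplecticForm O (L ((extChartAt (𝓡 2) x₀).symm z))
      (mfderiv (𝓡 2) (𝓡 4) L ((extChartAt (𝓡 2) x₀).symm z)
        (mfderiv 𝓘(ℝ, EuclideanSpace ℝ (Fin 2)) (𝓡 2) (extChartAt (𝓡 2) x₀).symm z a))
      (mfderiv (𝓡 2) (𝓡 4) L ((extChartAt (𝓡 2) x₀).symm z)
        (mfderiv 𝓘(ℝ, EuclideanSpace ℝ (Fin 2)) (𝓡 2) (extChartAt (𝓡 2) x₀).symm z b)) := by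
  rw [fderiv_comp_extChartAt_symm hL (OrientedLine.contMDiff_foot O) x₀ hz,
    fderiv_comp_extChartAt_symm hL (OrientedLine.contMDiff_foot O) x₀ hz,
    fderiv_comp_extChartAt_symm hL OrientedLine.contMDiff_dir x₀ hz,
    fderiv_comp_extChartAt_symm hL OrientedLine.contMDiff_dir x₀ hz]
  rfl

/-- If the form vanishes in the chart at `x₀`, then it vanishes at `x₀`. -/
lemma symplecticForm_eq_zero_of_extChartAt (O : E) {L : F → OrientedLine V E}
    (hL : ContMDiff (𝓡 2) (𝓡 4) ∞ L) (x₀ : F)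
    (h : ∀ a b,
      (inner ℝ (fderiv ℝ (OrientedLine.foot O ∘ L ∘ (extChartAt (𝓡 2) x₀).symm)
          (extChartAt (𝓡 2) x₀ x₀) a)
        (fderiv ℝ (OrientedLine.dir ∘ L ∘ (extChartAt (𝓡 2) x₀).symm)
          (extChartAt (𝓡 2) x₀ x₀) b) -
      inner ℝ (fderiv ℝ (OrientedLine.foot O ∘ L ∘ (extChartAt (𝓡 2) x₀).symm)
          (extChartAt (𝓡 2) x₀ x₀) b)
        (fderiv ℝ (OrientedLine.dir ∘ L ∘ (extChartAt (𝓡 2) x₀).symm)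
          (extChartAt (𝓡 2) x₀ x₀) a) : ℝ) = 0) (ξ η : TangentSpace (𝓡 2) x₀) :
    OrientedLine.symplecticForm O (L x₀) (mfderiv (𝓡 2) (𝓡 4) L x₀ ξ)
      (mfderiv (𝓡 2) (𝓡 4) L x₀ η) = 0 := by
  have hz := mem_extChartAt_target (I := 𝓡 2) x₀
  -- Every tangent vector is the image of a chart vector, so vanishing in the chart is enough. The
  -- claim is made at the chart's preimage of its own value at `x₀`, where the chain rule applies,
  -- and then transported to `x₀`.
  have key : ∀ ξ η : TangentSpace (𝓡 2) ((extChartAt (𝓡 2) x₀).symm (extChartAt (𝓡 2) x₀ x₀)),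
      OrientedLine.symplecticForm O (L ((extChartAt (𝓡 2) x₀).symm (extChartAt (𝓡 2) x₀ x₀)))
        (mfderiv (𝓡 2) (𝓡 4) L _ ξ) (mfderiv (𝓡 2) (𝓡 4) L _ η) = 0 := by
    intro ξ η
    obtain ⟨a, rfl⟩ := mfderiv_extChartAt_symm_surjective x₀ hz ξ
    obtain ⟨b, rfl⟩ := mfderiv_extChartAt_symm_surjective x₀ hz η
    exact (symplecticForm_mfderiv_extChartAt_symm O hL x₀ hz a b).symm.trans (h a b)
  rw [extChartAt_to_inv] at key
  exact key ξ η

/-- If the points `m` lie on the rays, then the form `dm ∧ du` is, in a chart, the form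
`dP ∧ du` of the feet of the perpendiculars. -/
lemma wedge_foot_eq (O : E) {L : F → OrientedLine V E}
    (hL : ContMDiff (𝓡 2) (𝓡 4) ∞ L) (x₀ : F) {U : Set F} (hU : IsOpen U) {m : F → E}
    (hmL : ∀ x ∈ U, m x ∈ L x) (hm : ContMDiffOn (𝓡 2) 𝓘(ℝ, V) ∞ (fun x => m x -ᵥ O) U)
    {z : EuclideanSpace ℝ (Fin 2)}
    (hz : z ∈ (extChartAt (𝓡 2) x₀).target ∩ (extChartAt (𝓡 2) x₀).symm ⁻¹' U)
    (a b : EuclideanSpace ℝ (Fin 2)) :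
    (inner ℝ (fderiv ℝ ((fun x => m x -ᵥ O) ∘ (extChartAt (𝓡 2) x₀).symm) z a)
        (fderiv ℝ (OrientedLine.dir ∘ L ∘ (extChartAt (𝓡 2) x₀).symm) z b) -
      inner ℝ (fderiv ℝ ((fun x => m x -ᵥ O) ∘ (extChartAt (𝓡 2) x₀).symm) z b)
        (fderiv ℝ (OrientedLine.dir ∘ L ∘ (extChartAt (𝓡 2) x₀).symm) z a) : ℝ) =
    inner ℝ (fderiv ℝ (OrientedLine.foot O ∘ L ∘ (extChartAt (𝓡 2) x₀).symm) z a)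
        (fderiv ℝ (OrientedLine.dir ∘ L ∘ (extChartAt (𝓡 2) x₀).symm) z b) -
      inner ℝ (fderiv ℝ (OrientedLine.foot O ∘ L ∘ (extChartAt (𝓡 2) x₀).symm) z b)
        (fderiv ℝ (OrientedLine.dir ∘ L ∘ (extChartAt (𝓡 2) x₀).symm) z a) := by
  have hnhds := (isOpen_extChartAt_target_inter_preimage x₀ hU).mem_nhds hz
  have hQ := (contDiffOn_comp_extChartAt_symm x₀ hm).contDiffAt hnhds
  have hu : ContDiffAt ℝ ∞ (OrientedLine.dir ∘ L ∘ (extChartAt (𝓡 2) x₀).symm) z :=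
    (contDiffOn_comp_extChartAt_symm x₀ (OrientedLine.contMDiff_dir.comp hL).contMDiffOn).contDiffAt
      hnhds
  -- The foot of the perpendicular from `O` is `m` slid along the ray by `-u · Om`, a smooth amount.
  have ht := (hu.inner ℝ hQ).neg
  rw [← wedge_add_smul (hQ.differentiableAt (by simp)) (hu.differentiableAt (by simp))
    (ht.differentiableAt (by simp))
    (Filter.Eventually.of_forall fun y => (L ((extChartAt (𝓡 2) x₀).symm y)).norm_dir) a b]
  have hP : OrientedLine.foot O ∘ L ∘ (extChartAt (𝓡 2) x₀).symm =ᶠ[𝓝 z] fun y =>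
      ((fun x => m x -ᵥ O) ∘ (extChartAt (𝓡 2) x₀).symm) y +
        (-inner ℝ ((OrientedLine.dir ∘ L ∘ (extChartAt (𝓡 2) x₀).symm) y)
          (((fun x => m x -ᵥ O) ∘ (extChartAt (𝓡 2) x₀).symm) y) : ℝ) •
        (OrientedLine.dir ∘ L ∘ (extChartAt (𝓡 2) x₀).symm) y := by
    filter_upwards [hnhds] with y hy
    simp only [Function.comp_apply, neg_smul, ← sub_eq_add_neg]
    exact OrientedLine.foot_eq O (hmL _ hy.2)
  rw [hP.fderiv_eq]

end ChartExpressions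

/-! ### The two implications between Lagrangian and rectangular -/

section Rectangular

variable {V E : Type*} [NormedAddCommGroup V] [InnerProductSpace ℝ V]
  [MetricSpace E] [NormedAddTorsor V E]
  {F : Type*} [TopologicalSpace F] [ChartedSpace (EuclideanSpace ℝ (Fin 2)) F]

/-- Smoothness of a map into `E` does not depend on the origin. -/
lemma contMDiffOn_vsub_origin (O O' : E) {U : Set F} {m : F → E}
    (hm : ContMDiffOn (𝓡 2) 𝓘(ℝ, V) ∞ (fun x => m x -ᵥ O') U) :
    ContMDiffOn (𝓡 2) 𝓘(ℝ, V) ∞ (fun x => m x -ᵥ O) U := by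
  have h := hm.add (contMDiffOn_const (c := O' -ᵥ O))
  refine h.congr fun x _ => ?_
  exact (vsub_add_vsub_cancel (m x) O' O).symm

variable [IsManifold (𝓡 2) ∞ F]

/-- A map into `E` with a smooth left inverse has an injective derivative. -/
lemma injective_fderiv_of_leftInverse (x₀ : F) {U : Set F} (hU : IsOpen U) (hx₀ : x₀ ∈ U)
    (O : E) {m : F → E} {g : E → F} {A : Set E} (hmA : ∀ x ∈ U, m x ∈ A)
    (hgm : ∀ x ∈ U, g (m x) = x)
    (hm : ContMDiffOn (𝓡 2) 𝓘(ℝ, V) ∞ (fun x => m x -ᵥ O) U)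
    (hg : ContMDiffOn 𝓘(ℝ, V) (𝓡 2) ∞ (fun v : V => g (v +ᵥ m x₀)) {v | v +ᵥ m x₀ ∈ A}) :
    Function.Injective (fderiv ℝ ((fun x => m x -ᵥ O) ∘ (extChartAt (𝓡 2) x₀).symm)
      (extChartAt (𝓡 2) x₀ x₀)) := by
  set z₀ := extChartAt (𝓡 2) x₀ x₀ with hz₀
  have hΨ : (extChartAt (𝓡 2) x₀).symm z₀ = x₀ := extChartAt_to_inv x₀
  have hnhds : (extChartAt (𝓡 2) x₀).target ∩ (extChartAt (𝓡 2) x₀).symm ⁻¹' U ∈ 𝓝 z₀ :=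
    (isOpen_extChartAt_target_inter_preimage x₀ hU).mem_nhds
      ⟨mem_extChartAt_target x₀, by rw [Set.mem_preimage, hΨ]; exact hx₀⟩
  have hQ := ((contDiffOn_comp_extChartAt_symm x₀ hm).contDiffAt hnhds).differentiableAt (by simp)
  have h0 : (0 : V) ∈ {v : V | v +ᵥ m x₀ ∈ A} := by
    change (0 : V) +ᵥ m x₀ ∈ A
    rw [zero_vadd]
    exact hmA x₀ hx₀
  -- `g` is smooth only along `A`, so its derivative is taken within that set. The chain rule still
  -- applies because `m` takes its values in `A` near `x₀`.
  have hk : DifferentiableWithinAt ℝ (fun v : V => extChartAt (𝓡 2) x₀ (g (v +ᵥ m x₀)))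
      {v | v +ᵥ m x₀ ∈ A} 0 := by
    rw [← mdifferentiableWithinAt_iff_differentiableWithinAt]
    have h1 : MDifferentiableAt (𝓡 2) 𝓘(ℝ, EuclideanSpace ℝ (Fin 2)) (extChartAt (𝓡 2) x₀)
        (g ((0 : V) +ᵥ m x₀)) := by
      rw [zero_vadd, hgm x₀ hx₀]
      exact mdifferentiableAt_extChartAt (mem_chart_source _ x₀)
    exact h1.comp_mdifferentiableWithinAt (0 : V)
      ((hg 0 h0).mdifferentiableWithinAt (by simp))
  -- Displacements are recentred at `m x₀`, the base point used for `g`; this subtracts a constant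
  -- and leaves the derivative unchanged.
  set R : EuclideanSpace ℝ (Fin 2) → V := fun z => ((fun x => m x -ᵥ O) ∘
    (extChartAt (𝓡 2) x₀).symm) z - (m x₀ -ᵥ O) with hR
  have hRd : HasFDerivAt R (fderiv ℝ ((fun x => m x -ᵥ O) ∘ (extChartAt (𝓡 2) x₀).symm) z₀) z₀ :=
    hQ.hasFDerivAt.sub_const _
  have hR0 : R z₀ = 0 := by simp only [hR, Function.comp_apply, hΨ, sub_self]
  have hRm : ∀ z, R z +ᵥ m x₀ = m ((extChartAt (𝓡 2) x₀).symm z) := by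
    intro z
    simp only [hR, Function.comp_apply, vsub_sub_vsub_cancel_right, vsub_vadd]
  rw [← hR0] at hk
  have hev : ∀ᶠ z in 𝓝 z₀, R z ∈ {v : V | v +ᵥ m x₀ ∈ A} := by
    filter_upwards [hnhds] with z hz
    rw [hRm]
    exact hmA _ hz.2
  have hcomp := hk.hasFDerivWithinAt.comp_hasFDerivAt z₀ hRd hev
  have hid : (fun v : V => extChartAt (𝓡 2) x₀ (g (v +ᵥ m x₀))) ∘ R =ᶠ[𝓝 z₀] id := by
    filter_upwards [hnhds] with z hz
    rw [Function.comp_apply, hRm, hgm _ hz.2, id, PartialEquiv.right_inv _ hz.1]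
  have hD := (hcomp.congr_of_eventuallyEq hid.symm).unique (hasFDerivAt_id z₀)
  refine Function.LeftInverse.injective (g := fderivWithin ℝ
    (fun v : V => extChartAt (𝓡 2) x₀ (g (v +ᵥ m x₀))) {v | v +ᵥ m x₀ ∈ A} (R z₀)) fun a => ?_
  exact congrArg (fun D : EuclideanSpace ℝ (Fin 2) →L[ℝ] EuclideanSpace ℝ (Fin 2) => D a) hD

/-- The displacements of a point which moves on a surface are tangent to the surface. -/
lemma fderiv_mem_tangentVectors (O : E) (x₀ : F) {U : Set F} (hU : IsOpen U) {m : F → E}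
    {S : Set E} (hmS : ∀ x ∈ U, m x ∈ S)
    (hm : ContMDiffOn (𝓡 2) 𝓘(ℝ, V) ∞ (fun x => m x -ᵥ O) U)
    {z : EuclideanSpace ℝ (Fin 2)}
    (hz : z ∈ (extChartAt (𝓡 2) x₀).target ∩ (extChartAt (𝓡 2) x₀).symm ⁻¹' U)
    (a : EuclideanSpace ℝ (Fin 2)) :
    fderiv ℝ ((fun x => m x -ᵥ O) ∘ (extChartAt (𝓡 2) x₀).symm) z a ∈
      tangentVectors S (m ((extChartAt (𝓡 2) x₀).symm z)) := by
  have hnhds := (isOpen_extChartAt_target_inter_preimage x₀ hU).mem_nhds hz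
  have hQ := (contDiffOn_comp_extChartAt_symm x₀ hm).contDiffAt hnhds
  set Q := (fun x => m x -ᵥ O) ∘ (extChartAt (𝓡 2) x₀).symm with hQdef
  have hl0 : z + (0 : ℝ) • a = z := by simp
  have hline : ContDiff ℝ ∞ fun t : ℝ => z + t • a := by fun_prop
  have hlined : HasDerivAt (fun t : ℝ => z + t • a) a 0 := by
    simpa using ((hasDerivAt_id (0 : ℝ)).smul_const a).const_add z
  have hγ : (fun t : ℝ => m ((extChartAt (𝓡 2) x₀).symm (z + t • a)) -ᵥ
      m ((extChartAt (𝓡 2) x₀).symm z)) = fun t => Q (z + t • a) - Q z := by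
    funext t
    simp [hQdef]
  -- The required curve is traced by `m` over the segment `z + t a` in the chart.
  refine ⟨fun t => m ((extChartAt (𝓡 2) x₀).symm (z + t • a)), by simp, ?_, ?_, ?_⟩
  · have hc : ContinuousAt (fun t : ℝ => z + t • a) 0 := hline.continuous.continuousAt
    filter_upwards [hc.preimage_mem_nhds (by rw [hl0]; exact hnhds)] with t ht
    exact hmS _ ht.2
  · rw [hγ]
    rw [← hl0] at hQ
    exact (hQ.comp (0 : ℝ) hline.contDiffAt).sub contDiffAt_const
  · rw [hγ]
    have hQd : HasFDerivAt Q (fderiv ℝ Q z) (z + (0 : ℝ) • a) := by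
      rw [hl0]
      exact (hQ.differentiableAt (by simp)).hasFDerivAt
    exact (hQd.comp_hasDerivAt (0 : ℝ) hlined).sub_const _

variable [Fact (Module.finrank ℝ V = 3)]

/-- A Lagrangian family of rays is rectangular. -/
lemma IsLagrangian.isRectangular {O : E} {L : F → OrientedLine V E}
    (hL : ContMDiff (𝓡 2) (𝓡 4) ∞ L) (hLag : IsLagrangian O L) : IsRectangular L := by
  intro x₀ m₀ hreg
  have h3 : Module.finrank ℝ V = 3 := Fact.out
  have : FiniteDimensional ℝ V := Module.finite_of_finrank_eq_succ h3
  obtain ⟨hm₀, hreg⟩ := hreg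
  set u₀ := (L x₀).dir with hu₀
  have hu₀1 : ‖u₀‖ = 1 := (L x₀).norm_dir
  have hu₀0 : u₀ ≠ 0 := by
    rw [← norm_ne_zero_iff, hu₀1]
    exact one_ne_zero
  -- Any transverse surface would give smooth points `m x` on the rays. The orthogonal plane also
  -- gives `dQ · u = 0` at `z₀`, so the later sliding keeps the differential injective there.
  set S₀ := {q : E | (inner ℝ u₀ (q -ᵥ m₀) : ℝ) = 0} with hS₀
  obtain ⟨U, hU, hx₀, W, hW, hm₀W, m, g, hmeet, hgm, -, hm, hg⟩ :=
    hreg S₀ (isSmoothSurface_plane m₀ hu₀0) (by simp [hS₀]) fun h => by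
      have := inner_eq_zero_of_mem_tangentVectors_plane h
      rw [real_inner_self_eq_norm_sq, hu₀1] at this
      norm_num at this
  have hmx₀ : m x₀ = m₀ :=
    ((hmeet x₀ hx₀ m₀).mp ⟨⟨by simp [hS₀], hm₀W⟩, hm₀⟩).symm
  have hmSW : ∀ x ∈ U, m x ∈ S₀ ∩ W := fun x hx => ((hmeet x hx _).mpr rfl).1
  have hmL : ∀ x ∈ U, m x ∈ L x := fun x hx => ((hmeet x hx _).mpr rfl).2
  have hmO := contMDiffOn_vsub_origin O m₀ hm
  set Ψ := (extChartAt (𝓡 2) x₀).symm with hΨ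
  set z₀ := extChartAt (𝓡 2) x₀ x₀ with hz₀
  have hΨz₀ : Ψ z₀ = x₀ := extChartAt_to_inv x₀
  set Ω := (extChartAt (𝓡 2) x₀).target ∩ Ψ ⁻¹' U with hΩ
  have hΩo : IsOpen Ω := isOpen_extChartAt_target_inter_preimage x₀ hU
  have hz₀Ω : z₀ ∈ Ω := ⟨mem_extChartAt_target x₀, by rw [Set.mem_preimage, hΨz₀]; exact hx₀⟩
  set Q : EuclideanSpace ℝ (Fin 2) → V := (fun x => m x -ᵥ O) ∘ Ψ with hQ
  set u : EuclideanSpace ℝ (Fin 2) → V := OrientedLine.dir ∘ L ∘ Ψ with hu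
  have hQs : ContDiffOn ℝ ∞ Q Ω := contDiffOn_comp_extChartAt_symm x₀ hmO
  have hus : ContDiffOn ℝ ∞ u Ω := contDiffOn_comp_extChartAt_symm x₀
    (OrientedLine.contMDiff_dir.comp hL).contMDiffOn
  have hn : ∀ z ∈ Ω, ‖u z‖ = 1 := fun z _ => (L (Ψ z)).norm_dir
  have huz₀ : u z₀ = u₀ := by simp only [hu, Function.comp_apply, hΨz₀, hu₀]
  have hinj : Function.Injective (fderiv ℝ Q z₀) :=
    injective_fderiv_of_leftInverse x₀ hU hx₀ O hmSW hgm hmO (by rwa [hmx₀])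
  have hω : ∀ z ∈ Ω, ∀ a b, (inner ℝ (fderiv ℝ Q z a) (fderiv ℝ u z b) -
      inner ℝ (fderiv ℝ Q z b) (fderiv ℝ u z a) : ℝ) = 0 := by
    intro z hz a b
    refine (wedge_foot_eq O hL x₀ hU hmL hmO hz a b).trans ?_
    rw [symplecticForm_mfderiv_extChartAt_symm O hL x₀ hz.1]
    exact (hLag _).1 _ _
  have hz : ∀ a, inner ℝ (fderiv ℝ Q z₀ a) (u z₀) = (0 : ℝ) := by
    intro a
    have h := fderiv_mem_tangentVectors O x₀ hU (fun x hx => (hmSW x hx).1) hmO hz₀Ω a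
    rw [huz₀, real_inner_comm]
    exact inner_eq_zero_of_mem_tangentVectors_plane h
  obtain ⟨Ω₁, hΩ₁, hΩ₁o, hz₀Ω₁, s, hs, hs0, horth, hNd⟩ :=
    exists_orthogonal_displacement hΩo hz₀Ω hQs hus hn hω hz
  obtain ⟨S, hS, hNS, Ω₂, hΩ₂, hΩ₂o, hz₀Ω₂, hcross⟩ :=
    exists_surface_of_orthogonal_displacement (N := fun y => Q y + s y • u y) (by simp [h3]) O hΩ₁o hz₀Ω₁
      ((hQs.mono hΩ₁).add (hs.smul (hus.mono hΩ₁))) (hus.mono hΩ₁) (fun z hz => hn z (hΩ₁ hz))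
      horth (by rw [hNd]; exact hinj)
  refine ⟨S, hS, ?_, (extChartAt (𝓡 2) x₀).source ∩ extChartAt (𝓡 2) x₀ ⁻¹' Ω₂,
    isOpen_extChartAt_preimage' x₀ hΩ₂o, ⟨mem_extChartAt_source x₀, hz₀Ω₂⟩, ?_⟩
  · have h : (Q z₀ + s z₀ • u z₀) +ᵥ O = m₀ := by
      simp [hs0, hQ, hΨz₀, hmx₀]
    rw [← h]
    exact hNS
  · rintro x ⟨hxs, hx⟩
    set z := extChartAt (𝓡 2) x₀ x with hzx
    have hΨz : Ψ z = x := PartialEquiv.left_inv _ hxs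
    have hxU : x ∈ U := by
      have := (hΩ₁ (hΩ₂ hx)).2
      rwa [Set.mem_preimage, hΨz] at this
    obtain ⟨h1, h2⟩ := hcross z hx
    have huz : u z = (L x).dir := by simp only [hu, Function.comp_apply, hΨz]
    have hNL : (Q z + s z • u z) +ᵥ O ∈ L x := by
      have h : (Q z + s z • u z) +ᵥ O = s z • (L x).dir +ᵥ m x := by
        rw [huz, add_comm, add_vadd]
        simp only [hQ, Function.comp_apply, hΨz, vsub_vadd]
      rw [h]
      exact (L x).smul_vadd_mem (hmL x hxU) _
    -- An arbitrary common point of the ray and `S` is written as `N z + τ u z`, the form covered by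
    -- `hcross`.
    refine ⟨⟨_, h1, hNL⟩, fun p hpS hpL v hv => ?_⟩
    obtain ⟨τ, hτ⟩ := (L x).exists_eq_add_smul hNL hpL
    have hp : p = (Q z + s z • u z + τ • u z) +ᵥ O := by
      rw [add_comm, add_vadd, eq_vadd_iff_vsub_eq, hτ, huz]
    rw [hp] at hpS hv
    rw [← huz]
    exact h2 τ hpS v hv

/-- A rectangular family of rays with a regular point on each ray is Lagrangian. -/
lemma IsRectangular.isLagrangian {O : E} {L : F → OrientedLine V E}
    (hL : ContMDiff (𝓡 2) (𝓡 4) ∞ L) (hreg : ∀ x, ∃ m, IsRegularPoint L x m)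
    (hrect : IsRectangular L) : IsLagrangian O L := by
  intro x₀
  refine ⟨?_, ?_⟩
  swap
  · change 2 * Module.finrank ℝ (EuclideanSpace ℝ (Fin 2)) =
      Module.finrank ℝ (EuclideanSpace ℝ (Fin 4))
    simp
  obtain ⟨m₀, hm₀⟩ := hreg x₀
  obtain ⟨S, hS, hm₀S, U₁, hU₁, hx₀U₁, hcross⟩ := hrect x₀ m₀ hm₀
  have htrans : (L x₀).dir ∉ tangentVectors S m₀ := fun h => by
    have := (hcross x₀ hx₀U₁).2 m₀ hm₀S hm₀.1 _ h
    rw [real_inner_self_eq_norm_sq, (L x₀).norm_dir] at this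
    norm_num at this
  -- Regularity is applied to the orthogonal surface itself: it supplies the smooth choice of a
  -- point on each ray, while `U₁` supplies orthogonality.
  obtain ⟨U₂, hU₂, hx₀U₂, W, -, -, m, -, hmeet, -, -, hm, -⟩ := hm₀.2 S hS hm₀S htrans
  have hU := hU₁.inter hU₂
  have hmS : ∀ x ∈ U₁ ∩ U₂, m x ∈ S := fun x hx => ((hmeet x hx.2 _).mpr rfl).1.1
  have hmL : ∀ x ∈ U₁ ∩ U₂, m x ∈ L x := fun x hx => ((hmeet x hx.2 _).mpr rfl).2
  have hmO := contMDiffOn_vsub_origin O m₀ (hm.mono (Set.inter_subset_right (s := U₁)))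
  have hz₀ : extChartAt (𝓡 2) x₀ x₀ ∈ (extChartAt (𝓡 2) x₀).target ∩
      (extChartAt (𝓡 2) x₀).symm ⁻¹' (U₁ ∩ U₂) :=
    ⟨mem_extChartAt_target x₀, by
      rw [Set.mem_preimage, extChartAt_to_inv]
      exact ⟨hx₀U₁, hx₀U₂⟩⟩
  have hnhds := (isOpen_extChartAt_target_inter_preimage x₀ hU).mem_nhds hz₀
  refine symplecticForm_eq_zero_of_extChartAt O hL x₀ fun a b => ?_
  refine (wedge_foot_eq O hL x₀ hU hmL hmO hz₀ a b).symm.trans ?_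
  refine wedge_eq_zero_of_orthogonal
    ((contDiffOn_comp_extChartAt_symm x₀ hmO).contDiffAt hnhds)
    ((contDiffOn_comp_extChartAt_symm x₀
      ((OrientedLine.contMDiff_dir.comp hL).contMDiffOn (s := U₁ ∩ U₂))).contDiffAt hnhds) ?_ a b
  filter_upwards [hnhds] with z hz c
  exact (hcross _ hz.2.1).2 _ (hmS _ hz.2) (hmL _ hz.2) _
    (fderiv_mem_tangentVectors O x₀ hU hmS hmO hz c)

end Rectangular

/-! ### The main theorem -/

theorem mainTheorem3 {V E : Type*} [NormedAddCommGroup V] [InnerProductSpace ℝ V]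
    [Fact (Module.finrank ℝ V = 3)] [MetricSpace E] [NormedAddTorsor V E] (O : E)
    {F : Type*} [TopologicalSpace F] [ChartedSpace (EuclideanSpace ℝ (Fin 2)) F]
    [IsManifold (𝓡 2) ∞ F] (L : F → OrientedLine V E)
    (hL : Manifold.IsImmersion (𝓡 2) (𝓡 4) ∞ L) :
    (IsLagrangian O L → IsRectangular L) ∧
      ((∀ x, ∃ m, IsRegularPoint L x m) → (IsRectangular L ↔ IsLagrangian O L)) := by
  have hL' : ContMDiff (𝓡 2) (𝓡 4) ∞ L := hL.contMDiff
  exact ⟨fun h => h.isRectangular hL', fun hreg =>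
    ⟨fun h => h.isLagrangian hL' hreg, fun h => h.isRectangular hL'⟩⟩
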